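/- **Setting.** A correlation is a family of real numbers $\vec P=\{P(a,b|x,y)\}_{a,b,x,y\in\{0,1\}}$. The set $\mathcal Q$ of quantum correlations consists of all $\vec P$ with $P(a,b|x,y)=\mathrm{tr}\big[(M^A_{a|x}\otimes M^B_{b|y})\rho\big]$, where $\rho$ is a (pure or mixed) state on the tensor product $\mathcal H_A\otimes\mathcal H_B$ of two complex Hilbert spaces of arbitrary dimension, and, for every $x$ and $y$, $\{M^A_{a|x}\}_{a=0,1}$ and $\{M^B_{b|y}\}_{b=0,1}$ are POVMs on $\mathcal H_A$ and $\mathcal H_B$. Put $$\mathcal Q_{2b}=\{\vec P\in\mathcal Q:\ P(0,0|0,0)=P(1,1|1,0)=0\},\qquad \mathcal S_{\rm CHSH}(\vec P)=\sum_{x,y,a,b=0}^{1}(-1)^{xy+a+b+1}P(a,b|x,y).$$ Let $\vec P_{Q,3}$ be the correlation with $$\begin{array}{c|cccc} (x,y) & P(0,0|x,y) & P(0,1|x,y) & P(1,0|x,y) & P(1,1|x,y)\\\hline (0,0) & 0 & 3/8 & 1/2 & 1/8\\ (0,1) & 3/16 & 3/16 & 9/16 & 1/16\\ (1,0) & 1/8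 & 1/2 & 3/8 & 0\\ (1,1) & 9/16 & 1/16 & 3/16 & 3/16\end{array}$$ and let the reference strategy be the two-qubit pure state $$|\widetilde\psi\rangle=\sin\theta\,(\cos\alpha|0\rangle-\sin\alpha|1\rangle)|1\rangle+\cos\theta\,|1\rangle|0\rangle$$ with the observables $$\widetilde A_0=\widetilde B_0=\sigma_z,\qquad \widetilde A_1=\cos2\alpha\,\sigma_z-\sin2\alpha\,\sigma_x,\qquad \widetilde B_1=\cos2\beta\,\sigma_z-\sin2\beta\,\sigma_x,$$ where $\alpha=\frac{\pi}{6}$ and $\beta=\theta=\frac{\pi}{4}$, and with the corresponding measurements $\widetilde M^A_{a|x}=\frac12(\mathbb 1+(-1)^a\widetilde A_x)$, $\widetilde M^B_{b|y}=\frac12(\mathbb 1+(-1)^b\widetilde B_y)$. A strategy consisting of a unit vector $|\psi\rangle\in\mathcal H_A\otimes\mathcal H_B$ and POVMs $\{M^A_{a|x}\}$, $\{M^B_{b|y}\}$ is said to be equivalent to the reference strategy up to local isometries if there are Hilbert spaces $\mathcal H_{A'},\mathcal H_{B'}$, linear isometries $\Phi_A:\mathcal H_A\to\mathcal H_{A'}\otimes\mathbb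 C^2$, $\Phi_B:\mathcal H_B\to\mathcal H_{B'}\otimes\mathbb C^2$ and a unit vector $|\varsigma\rangle\in\mathcal H_{A'}\otimes\mathcal H_{B'}$ such that, for all $a,b,x,y$ (and with the tensor factors regrouped by party), $$(\Phi_A\otimes\Phi_B)\big(M^A_{a|x}\otimes M^B_{b|y}|\psi\rangle\big)=|\varsigma\rangle\otimes\big(\widetilde M^A_{a|x}\otimes\widetilde M^B_{b|y}|\widetilde\psi\rangle\big).$$ **Theorem.** 1. $\max_{\vec P\in\mathcal Q_{2b}}\mathcal S_{\rm CHSH}(\vec P)=\frac52$, and the maximum is attained. 2. For $\vec P\in\mathcal Q_{2b}$, $\mathcal S_{\rm CHSH}(\vec P)=\frac52$ if and only if $\vec P=\vec P_{Q,3}$. 3. $\vec P_{Q,3}$ is an extreme point of $\mathcal Q$. 4. $\vec P_{Q,3}$ self-tests the reference strategy: the reference strategy realizes $\vec P_{Q,3}$, and every pure-state strategy (on Hilbert spaces of any dimension, with arbitrary POVMs) that realizes $\vec P_{Q,3}$ is equivalent to it up to local isometries. 5. In particular, every pure-state strategy whose correlation satisfies $P(0,0|0,0)=P(1,1|1,0)=0$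 and $\mathcal S_{\rm CHSH}=\frac52$ is equivalent to the reference strategy up to local isometries. -/

import Mathlib

open scoped TensorProduct

noncomputable section

/-! ### Hilbert tensor products -/

/-- The Hilbert-space tensor product: the completion of the algebraic tensor product with its
inner product `⟪x ⊗ y, x' ⊗ y'⟫ = ⟪x, x'⟫ ⟪y, y'⟫`. -/
def HTensor (H K : Type) [NormedAddCommGroup H] [InnerProductSpace ℂ H]
    [NormedAddCommGroup K] [InnerProductSpace ℂ K] : Type :=
  UniformSpace.Completion (H ⊗[ℂ] K)

section HTensor

variable {H K H' K' E : Type}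
  [NormedAddCommGroup H] [InnerProductSpace ℂ H]
  [NormedAddCommGroup K] [InnerProductSpace ℂ K]
  [NormedAddCommGroup H'] [InnerProductSpace ℂ H']
  [NormedAddCommGroup K'] [InnerProductSpace ℂ K']
  [NormedAddCommGroup E] [NormedSpace ℂ E]

instance : NormedAddCommGroup (HTensor H K) :=
  inferInstanceAs (NormedAddCommGroup (UniformSpace.Completion (H ⊗[ℂ] K)))

instance : InnerProductSpace ℂ (HTensor H K) :=
  inferInstanceAs (InnerProductSpace ℂ (UniformSpace.Completion (H ⊗[ℂ] K)))

instance : CompleteSpace (HTensor H K) :=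
  inferInstanceAs (CompleteSpace (UniformSpace.Completion (H ⊗[ℂ] K)))

/-- The inclusion of the algebraic tensor product. -/
def HTensor.of : H ⊗[ℂ] K →ₗᵢ[ℂ] HTensor H K :=
  (UniformSpace.Completion.toComplₗᵢ :
    H ⊗[ℂ] K →ₗᵢ[ℂ] UniformSpace.Completion (H ⊗[ℂ] K))

theorem HTensor.denseRange_of : DenseRange (HTensor.of : H ⊗[ℂ] K →ₗᵢ[ℂ] HTensor H K) :=
  UniformSpace.Completion.denseRange_coe

/-- The pure tensor `x ⊗ y`. -/
def HTensor.tmul (x : H) (y : K) : HTensor H K := HTensor.of (x ⊗ₜ[ℂ] y)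

theorem HTensor.inner_tmul (x x' : H) (y y' : K) :
    inner ℂ (HTensor.tmul x y) (HTensor.tmul x' y') = inner ℂ x x' * inner ℂ y y' := by
  rw [HTensor.tmul, HTensor.tmul, LinearIsometry.inner_map_map, TensorProduct.inner_tmul]

theorem HTensor.ext {f g : HTensor H K →L[ℂ] E}
    (h : ∀ x y, f (HTensor.tmul x y) = g (HTensor.tmul x y)) : f = g := by
  apply ContinuousLinearMap.coeFn_injective
  refine HTensor.denseRange_of.equalizer f.continuous g.continuous (funext fun t => ?_)
  induction t using TensorProduct.induction_on with
  | zero => simp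
  | add a b ha hb =>
    simp only [Function.comp_apply, map_add] at ha hb ⊢
    rw [ha, hb]
  | tmul x y => exact h x y

/-- The operator `f ⊗ g` between Hilbert-space tensor products: the continuous extension of the
tensor product of `f` and `g` on the algebraic tensor product. -/
def HTensor.map (f : H →L[ℂ] H') (g : K →L[ℂ] K') : HTensor H K →L[ℂ] HTensor H' K' :=
  ContinuousLinearMap.extend
    ((HTensor.of : H' ⊗[ℂ] K' →ₗᵢ[ℂ] HTensor H' K').toContinuousLinearMap ∘L
      TensorProduct.mapL f g)
    (HTensor.of : H ⊗[ℂ] K →ₗᵢ[ℂ] HTensor H K).toContinuousLinearMap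

theorem HTensor.map_of (f : H →L[ℂ] H') (g : K →L[ℂ] K') (t : H ⊗[ℂ] K) :
    HTensor.map f g (HTensor.of t) = HTensor.of (TensorProduct.mapL f g t) :=
  ContinuousLinearMap.extend_eq
    ((HTensor.of : H' ⊗[ℂ] K' →ₗᵢ[ℂ] HTensor H' K').toContinuousLinearMap ∘L
      TensorProduct.mapL f g)
    (e := (HTensor.of : H ⊗[ℂ] K →ₗᵢ[ℂ] HTensor H K).toContinuousLinearMap)
    HTensor.denseRange_of HTensor.of.isometry.isUniformInducing t

theorem HTensor.map_tmul (f : H →L[ℂ] H') (g : K →L[ℂ] K') (x : H) (y : K) :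
    HTensor.map f g (HTensor.tmul x y) = HTensor.tmul (f x) (g y) := by
  rw [HTensor.tmul, HTensor.map_of, TensorProduct.mapL_tmul, HTensor.tmul]

theorem HTensor.add_tmul (x x' : H) (y : K) :
    HTensor.tmul (x + x') y = HTensor.tmul x y + HTensor.tmul x' y := by
  simp only [HTensor.tmul, TensorProduct.add_tmul, map_add]

theorem HTensor.tmul_add (x : H) (y y' : K) :
    HTensor.tmul x (y + y') = HTensor.tmul x y + HTensor.tmul x y' := by
  simp only [HTensor.tmul, TensorProduct.tmul_add, map_add]

theorem HTensor.smul_tmul (c : ℂ) (x : H) (y : K) :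
    HTensor.tmul (c • x) y = c • HTensor.tmul x y := by
  simp only [HTensor.tmul, ← TensorProduct.smul_tmul', map_smul]

theorem HTensor.tmul_smul (c : ℂ) (x : H) (y : K) :
    HTensor.tmul x (c • y) = c • HTensor.tmul x y := by
  simp only [HTensor.tmul, TensorProduct.tmul_smul, map_smul]

/-- The bounded linear map `x ↦ x ⊗ y`. -/
def HTensor.tmulRight (y : K) : H →L[ℂ] HTensor H K :=
  (HTensor.of : H ⊗[ℂ] K →ₗᵢ[ℂ] HTensor H K).toContinuousLinearMap ∘L
    (TensorProduct.mkL ℂ H K).flip y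

theorem HTensor.tmulRight_apply (x : H) (y : K) :
    HTensor.tmulRight y x = HTensor.tmul x y := rfl

/-- The vector `ς ⊗ (x' ⊗ y')` with the factors regrouped by party, that is, the bounded linear
map determined by `x ⊗ y ↦ (x ⊗ x') ⊗ (y ⊗ y')`, extended linearly from the pure tensors `x' ⊗ y'`
to all of the algebraic tensor product. -/
def HTensor.attach :
    H' ⊗[ℂ] K' →ₗ[ℂ] HTensor H K →L[ℂ] HTensor (HTensor H H') (HTensor K K') :=
  TensorProduct.lift <| LinearMap.mk₂ ℂ
    (fun (x' : H') (y' : K') => HTensor.map (HTensor.tmulRight x') (HTensor.tmulRight y'))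
    (fun _ _ _ => HTensor.ext fun _ _ => by
      simp only [HTensor.map_tmul, HTensor.tmulRight_apply, HTensor.tmul_add, HTensor.add_tmul,
        add_apply])
    (fun _ _ _ => HTensor.ext fun _ _ => by
      simp only [HTensor.map_tmul, HTensor.tmulRight_apply, HTensor.tmul_smul, HTensor.smul_tmul,
        smul_apply])
    (fun _ _ _ => HTensor.ext fun _ _ => by
      simp only [HTensor.map_tmul, HTensor.tmulRight_apply, HTensor.tmul_add,
        add_apply])
    (fun _ _ _ => HTensor.ext fun _ _ => by
      simp only [HTensor.map_tmul, HTensor.tmulRight_apply, HTensor.tmul_smul,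
        smul_apply])

theorem HTensor.attach_tmul (x : H) (y : K) (x' : H') (y' : K') :
    HTensor.attach (x' ⊗ₜ[ℂ] y') (HTensor.tmul x y)
      = HTensor.tmul (HTensor.tmul x x') (HTensor.tmul y y') := by
  rw [HTensor.attach, TensorProduct.lift.tmul]
  exact HTensor.map_tmul _ _ _ _

end HTensor

/-! ### Measurements, states and quantum correlations -/

/-- A dichotomic measurement: a two-outcome POVM on `H`. -/
structure Povm (H : Type) [NormedAddCommGroup H] [InnerProductSpace ℂ H] where
  effect : Fin 2 → (H →L[ℂ] H)
  isPositive : ∀ a, (effect a).IsPositive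
  sum_eq_one : effect 0 + effect 1 = 1

/-- A (pure or mixed) state on `H`, given as a countable mixture of pure states: the density
operator is `ρ = ∑ₖ weight k • |vec k⟩⟨vec k|`. -/
structure MixedState (H : Type) [NormedAddCommGroup H] [InnerProductSpace ℂ H] where
  weight : ℕ → ℝ
  vec : ℕ → H
  weight_nonneg : ∀ k, 0 ≤ weight k
  hasSum_weight : HasSum weight 1
  norm_vec : ∀ k, ‖vec k‖ = 1

/-- `ρ.HasExpectation T z` says that `tr (T ρ) = z`. -/
def MixedState.HasExpectation {H : Type} [NormedAddCommGroup H] [InnerProductSpace ℂ H]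
    (ρ : MixedState H) (T : H →L[ℂ] H) (z : ℂ) : Prop :=
  HasSum (fun k => (ρ.weight k : ℂ) * inner ℂ (ρ.vec k) (T (ρ.vec k))) z

/-- Correlations in the CHSH scenario: `P a b x y` is `P(a,b|x,y)`. -/
abbrev Correlation : Type := Fin 2 → Fin 2 → Fin 2 → Fin 2 → ℝ

/-- Born's rule for a bipartite state `ρ` and local POVMs: `M x` is Alice's measurement for the
setting `x`, and `N y` is Bob's measurement for the setting `y`. -/
def MixedRealizes {HA HB : Type} [NormedAddCommGroup HA] [InnerProductSpace ℂ HA]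
    [NormedAddCommGroup HB] [InnerProductSpace ℂ HB]
    (P : Correlation) (ρ : MixedState (HTensor HA HB))
    (M : Fin 2 → Povm HA) (N : Fin 2 → Povm HB) : Prop :=
  ∀ a b x y, ρ.HasExpectation (HTensor.map ((M x).effect a) ((N y).effect b)) (P a b x y : ℂ)

/-- The set of quantum correlations; the local Hilbert spaces may have any dimension. -/
def quantumSet : Set Correlation :=
  {P | ∃ (HA HB : Type) (_ : NormedAddCommGroup HA) (_ : InnerProductSpace ℂ HA)
      (_ : CompleteSpace HA) (_ : NormedAddCommGroup HB) (_ : InnerProductSpace ℂ HB)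
      (_ : CompleteSpace HB) (ρ : MixedState (HTensor HA HB))
      (M : Fin 2 → Povm HA) (N : Fin 2 → Povm HB), MixedRealizes P ρ M N}

/-- The quantum correlations with `P(0,0|0,0) = P(1,1|1,0) = 0`. -/
def quantumSet2b : Set Correlation :=
  {P | P ∈ quantumSet ∧ P 0 0 0 0 = 0 ∧ P 1 1 1 0 = 0}

/-- The CHSH value `∑ (-1)^(xy+a+b+1) P(a,b|x,y)`. -/
def chshValue (P : Correlation) : ℝ :=
  ∑ x : Fin 2, ∑ y : Fin 2, ∑ a : Fin 2, ∑ b : Fin 2,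
    (-1 : ℝ) ^ (x.val * y.val + a.val + b.val + 1) * P a b x y

/-! ### Self-testing -/

/-- Born's rule for a pure state: the unit vector `ψ` and the local POVMs `M`, `N` give `P`. -/
def Realizes {HA HB : Type} [NormedAddCommGroup HA] [InnerProductSpace ℂ HA]
    [NormedAddCommGroup HB] [InnerProductSpace ℂ HB]
    (P : Correlation) (ψ : HTensor HA HB)
    (M : Fin 2 → Povm HA) (N : Fin 2 → Povm HB) : Prop :=
  ‖ψ‖ = 1 ∧ ∀ a b x y,
    inner ℂ ψ (HTensor.map ((M x).effect a) ((N y).effect b) ψ) = (P a b x y : ℂ)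

/-- The strategy `(ψ, M, N)` is equivalent to the finite-dimensional reference strategy
`(ψ', M', N')` up to local isometries `Φ_A`, `Φ_B` and a junk state `ς`:
`(Φ_A ⊗ Φ_B) (M_{a|x} ⊗ N_{b|y}) ψ = ς ⊗ (M'_{a|x} ⊗ N'_{b|y}) ψ'` for all `a, b, x, y`. -/
def LocallyReducesTo {HA HB KA KB : Type}
    [NormedAddCommGroup HA] [InnerProductSpace ℂ HA]
    [NormedAddCommGroup HB] [InnerProductSpace ℂ HB]
    [NormedAddCommGroup KA] [InnerProductSpace ℂ KA] [FiniteDimensional ℂ KA]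
    [NormedAddCommGroup KB] [InnerProductSpace ℂ KB] [FiniteDimensional ℂ KB]
    (ψ : HTensor HA HB) (M : Fin 2 → Povm HA) (N : Fin 2 → Povm HB)
    (ψ' : KA ⊗[ℂ] KB) (M' : Fin 2 → Povm KA) (N' : Fin 2 → Povm KB) : Prop :=
  ∃ (HA' HB' : Type) (_ : NormedAddCommGroup HA') (_ : InnerProductSpace ℂ HA')
    (_ : CompleteSpace HA') (_ : NormedAddCommGroup HB') (_ : InnerProductSpace ℂ HB')
    (_ : CompleteSpace HB')
    (ΦA : HA →ₗᵢ[ℂ] HTensor HA' KA) (ΦB : HB →ₗᵢ[ℂ] HTensor HB' KB) (ς : HTensor HA' HB'),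
    ‖ς‖ = 1 ∧ ∀ a b x y,
      HTensor.map ΦA.toContinuousLinearMap ΦB.toContinuousLinearMap
          (HTensor.map ((M x).effect a) ((N y).effect b) ψ)
        = HTensor.attach (TensorProduct.mapL ((M' x).effect a) ((N' y).effect b) ψ') ς

/-- `P` self-tests the reference strategy `(ψ', M', N')`: this strategy realizes `P`, and every
pure-state strategy realizing `P`, on Hilbert spaces of any dimension, is equivalent to it up to
local isometries. -/
def SelfTests {KA KB : Type}
    [NormedAddCommGroup KA] [InnerProductSpace ℂ KA] [FiniteDimensional ℂ KA]
    [NormedAddCommGroup KB] [InnerProductSpace ℂ KB] [FiniteDimensional ℂ KB]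
    (P : Correlation) (ψ' : KA ⊗[ℂ] KB) (M' : Fin 2 → Povm KA) (N' : Fin 2 → Povm KB) : Prop :=
  Realizes P (HTensor.of ψ') M' N' ∧
  ∀ (HA HB : Type) [NormedAddCommGroup HA] [InnerProductSpace ℂ HA] [CompleteSpace HA]
    [NormedAddCommGroup HB] [InnerProductSpace ℂ HB] [CompleteSpace HB]
    (ψ : HTensor HA HB) (M : Fin 2 → Povm HA) (N : Fin 2 → Povm HB),
    Realizes P ψ M N → LocallyReducesTo ψ M N ψ' M' N'

/-! ### The reference qubit strategy and its correlation -/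

abbrev Qubit : Type := EuclideanSpace ℂ (Fin 2)

def ket (i : Fin 2) : Qubit := EuclideanSpace.single i 1

def pauliZ : Matrix (Fin 2) (Fin 2) ℂ := !![1, 0; 0, -1]

def pauliX : Matrix (Fin 2) (Fin 2) ℂ := !![0, 1; 1, 0]

/-- `cos(2t) σ_z - sin(2t) σ_x`. -/
def rotObservable (t : ℝ) : Matrix (Fin 2) (Fin 2) ℂ :=
  (Real.cos (2 * t) : ℂ) • pauliZ - (Real.sin (2 * t) : ℂ) • pauliX

theorem pauliZ_isHermitian : pauliZ.IsHermitian := by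
  ext i j; fin_cases i <;> fin_cases j <;> simp [pauliZ]

theorem pauliZ_sq : pauliZ * pauliZ = 1 := by
  ext i j; fin_cases i <;> fin_cases j <;> simp [pauliZ]

theorem rotObservable_isHermitian (t : ℝ) : (rotObservable t).IsHermitian := by
  ext i j; fin_cases i <;> fin_cases j <;>
    simp [rotObservable, pauliZ, pauliX, -Complex.ofReal_cos, -Complex.ofReal_sin]

theorem rotObservable_sq (t : ℝ) : rotObservable t * rotObservable t = 1 := by
  have h : (Real.cos (2 * t) : ℂ) * Real.cos (2 * t) + Real.sin (2 * t) * Real.sin (2 * t) = 1 := by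
    have := Real.cos_sq_add_sin_sq (2 * t)
    exact_mod_cast (by nlinarith : Real.cos (2 * t) * Real.cos (2 * t)
      + Real.sin (2 * t) * Real.sin (2 * t) = 1)
  ext i j; fin_cases i <;> fin_cases j <;>
    simp [rotObservable, pauliZ, pauliX, Matrix.mul_apply, Fin.sum_univ_two,
      -Complex.ofReal_cos, -Complex.ofReal_sin] <;> ring_nf <;>
    ring_nf at h <;> linear_combination h

/-- The effect `(1 + (-1)^a A) / 2` of the outcome `a` for a qubit observable `A`. -/
def observableEffect (A : Matrix (Fin 2) (Fin 2) ℂ) (a : Fin 2) : Matrix (Fin 2) (Fin 2) ℂ :=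
  (1 / 2 : ℂ) • (1 + (-1 : ℂ) ^ a.val • A)

open scoped ComplexOrder in
theorem observableEffect_posSemidef {A : Matrix (Fin 2) (Fin 2) ℂ} (hA : A.IsHermitian)
    (hA2 : A * A = 1) (a : Fin 2) : (observableEffect A a).PosSemidef := by
  have h : observableEffect A a = (observableEffect A a).conjTranspose * observableEffect A a := by
    have hs : (-1 : ℂ) ^ a.val * (-1 : ℂ) ^ a.val = 1 := by
      rw [← mul_pow]; simp
    have hc : (starRingEnd ℂ) ((-1 : ℂ) ^ a.val) = (-1 : ℂ) ^ a.val := by simp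
    have hH : (observableEffect A a).conjTranspose = observableEffect A a := by
      simp only [observableEffect, Matrix.conjTranspose_smul, Matrix.conjTranspose_add,
        Matrix.conjTranspose_one, hA.eq]
      simp
    rw [hH]
    simp only [observableEffect, Matrix.smul_mul, Matrix.mul_smul, add_mul, mul_add, one_mul,
      mul_one, hA2, smul_smul, smul_add]
    ext i j
    simp only [Matrix.add_apply, Matrix.smul_apply, smul_eq_mul]
    linear_combination (-(1/4 : ℂ) * (1 : Matrix (Fin 2) (Fin 2) ℂ) i j) * hs
  rw [h]
  exact Matrix.posSemidef_conjTranspose_mul_self _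

open scoped ComplexOrder in
/-- The projective measurement of a qubit observable `A = A†` with `A² = 1`. -/
def Povm.ofObservable (A : Matrix (Fin 2) (Fin 2) ℂ) (hA : A.IsHermitian) (hA2 : A * A = 1) :
    Povm Qubit where
  effect a := Matrix.toEuclideanCLM (n := Fin 2) (𝕜 := ℂ) (observableEffect A a)
  isPositive a := by
    rw [← ContinuousLinearMap.isPositive_toLinearMap_iff,
      Matrix.coe_toEuclideanCLM_eq_toEuclideanLin, Matrix.isPositive_toEuclideanLin_iff]
    exact observableEffect_posSemidef hA hA2 a
  sum_eq_one := by
    rw [← map_add]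
    have : observableEffect A 0 + observableEffect A 1 = 1 := by
      ext i j
      simp [observableEffect]
      ring
    rw [this, map_one]

/-- The measurements of the observables `σ_z` (setting `0`) and `cos(2t) σ_z - sin(2t) σ_x`
(setting `1`). -/
def refMeasurement (t : ℝ) (x : Fin 2) : Povm Qubit :=
  if x = 0 then Povm.ofObservable pauliZ pauliZ_isHermitian pauliZ_sq
  else Povm.ofObservable (rotObservable t) (rotObservable_isHermitian t) (rotObservable_sq t)

/-- `sin θ (cos α |0⟩ - sin α |1⟩)|1⟩ + cos θ |1⟩|0⟩`. -/
def refState (α θ : ℝ) : Qubit ⊗[ℂ] Qubit :=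
  (Real.sin θ : ℂ) • (((Real.cos α : ℂ) • ket 0 - (Real.sin α : ℂ) • ket 1) ⊗ₜ[ℂ] ket 1)
    + (Real.cos θ : ℂ) • (ket 1 ⊗ₜ[ℂ] ket 0)

/-- The correlation table; the blocks are indexed by `x`, then `y`, the entries of a block by `a`
(rows), then `b` (columns). -/
def correlationQ3 : Correlation := fun a b x y =>
  (![![!![0, 3/8; 1/2, 1/8],
       !![3/16, 3/16; 9/16, 1/16]],
     ![!![1/8, 1/2; 3/8, 0],
       !![9/16, 1/16; 3/16, 3/16]]] : Fin 2 → Fin 2 → Matrix (Fin 2) (Fin 2) ℝ) x y a b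

end

/-!
For a pure state `ψ` and projective measurements let `P`, `F` be Alice's projections for the
outcomes `1|0` and `0|1`, let `G` be Bob's projection for `0|0`, and let `B` be the negative of
Bob's observable for the setting `1`. The zero constraints say that `P` fixes `x = G ψ` and `F`
fixes `y = (1 - G) ψ`. Together with no-signalling they reduce the CHSH value to
`2 + 2 ⟪ψ, (1 - P - F)(1 + B) ψ⟫`, and `5/2` minus this value is half of

`‖x + 2 G B P (y + F x)‖² + ‖y + 2 (1 - G) B F (x + P y)‖²`
`  + 4 ‖G B (1 - P) F x‖² + 4 ‖(1 - G) B (1 - F) P y‖²`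

(`IsCHSHAlgebra.sum_of_squares`). This gives the bound. When all four vectors vanish,
`G B x = 0` and `(1 - G) B y = 0` (`IsCHSHAlgebra.compression_eq_zero`), whence `B x = -2 P y` and
`B y = -2 F x` (`IsCHSHAlgebra.relations`). Then `x`, `y`, `B x`, `B y` span a space that is
invariant under `P`, `F`, `G`, `B`, and these act on it by the matrices of the reference strategy.
The swap operators `-(4/√3) P F (1 - P)`, `P` for Alice and `G`, `G B (1 - G)` for Bob extract that
strategy from the state. They are isometric only on a subspace carrying the state, and are corrected
on its orthogonal complement (`exists_isometry_extending_swap`, `locallyReducesTo_of_swap`).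

Arbitrary two-outcome measurements are dilated to projective ones on `H ⊗ ℂ²` by the Halmos
construction, along an isometry that does not depend on the measurement
(`Povm.exists_dilation`). This gives the bound and the uniqueness of the correlation for all pure
strategies. To pull the isometries back, the dilation has to intertwine the measurements on the
state, which means `⟨E²⟩ = ⟨E⟩` for every effect `E`. As `E` is the average of the effects `E²` and
`2 E - E²`, this follows from the uniqueness of the correlation
(`Realizes.pureCorrelation_eq_of_average`).

A mixed-state correlation is a mixture of pure ones that inherit the zero constraints, and so does
every convex decomposition of `correlationQ3` in the quantum set; the bound and the uniqueness
therefore extend to mixed states and show that `correlationQ3` is extreme.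
-/

noncomputable section

/-! ### Operators on Hilbert tensor products -/

section HTensorAlgebra

variable {H K H' K' H'' K'' : Type}
  [NormedAddCommGroup H] [InnerProductSpace ℂ H]
  [NormedAddCommGroup K] [InnerProductSpace ℂ K]
  [NormedAddCommGroup H'] [InnerProductSpace ℂ H']
  [NormedAddCommGroup K'] [InnerProductSpace ℂ K']
  [NormedAddCommGroup H''] [InnerProductSpace ℂ H'']
  [NormedAddCommGroup K''] [InnerProductSpace ℂ K'']

theorem HTensor.eq_zero_of_inner_tmul {v : HTensor H K}
    (h : ∀ x y, inner ℂ v (HTensor.tmul x y) = 0) : v = 0 := by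
  have : innerSL ℂ v = (0 : HTensor H K →L[ℂ] ℂ) := HTensor.ext fun x y => by simpa using h x y
  have h2 : inner ℂ v v = 0 := by
    have := congrArg (fun f : HTensor H K →L[ℂ] ℂ => f v) this
    simpa using this
  exact inner_self_eq_zero.mp h2

theorem HTensor.map_comp (f : H' →L[ℂ] H'') (f' : H →L[ℂ] H') (g : K' →L[ℂ] K'')
    (g' : K →L[ℂ] K') :
    HTensor.map (f ∘L f') (g ∘L g') = HTensor.map f g ∘L HTensor.map f' g' :=
  HTensor.ext fun x y => by simp [HTensor.map_tmul]

theorem HTensor.map_map (f : H' →L[ℂ] H'') (f' : H →L[ℂ] H') (g : K' →L[ℂ] K'')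
    (g' : K →L[ℂ] K') (v : HTensor H K) :
    HTensor.map f g (HTensor.map f' g' v) = HTensor.map (f ∘L f') (g ∘L g') v := by
  rw [HTensor.map_comp]; rfl

theorem HTensor.map_one : HTensor.map (1 : H →L[ℂ] H) (1 : K →L[ℂ] K) = 1 :=
  HTensor.ext fun x y => by simp [HTensor.map_tmul]

theorem HTensor.map_add_left (f f' : H →L[ℂ] H') (g : K →L[ℂ] K') :
    HTensor.map (f + f') g = HTensor.map f g + HTensor.map f' g :=
  HTensor.ext fun x y => by simp [HTensor.map_tmul, HTensor.add_tmul]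

theorem HTensor.map_add_right (f : H →L[ℂ] H') (g g' : K →L[ℂ] K') :
    HTensor.map f (g + g') = HTensor.map f g + HTensor.map f g' :=
  HTensor.ext fun x y => by simp [HTensor.map_tmul, HTensor.tmul_add]

theorem HTensor.map_smul_left (c : ℂ) (f : H →L[ℂ] H') (g : K →L[ℂ] K') :
    HTensor.map (c • f) g = c • HTensor.map f g :=
  HTensor.ext fun x y => by simp [HTensor.map_tmul, HTensor.smul_tmul]

theorem HTensor.map_smul_right (c : ℂ) (f : H →L[ℂ] H') (g : K →L[ℂ] K') :
    HTensor.map f (c • g) = c • HTensor.map f g :=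
  HTensor.ext fun x y => by simp [HTensor.map_tmul, HTensor.tmul_smul]

theorem HTensor.map_neg_left (f : H →L[ℂ] H') (g : K →L[ℂ] K') :
    HTensor.map (-f) g = -HTensor.map f g := by
  simpa using HTensor.map_smul_left (-1) f g

theorem HTensor.map_neg_right (f : H →L[ℂ] H') (g : K →L[ℂ] K') :
    HTensor.map f (-g) = -HTensor.map f g := by
  simpa using HTensor.map_smul_right (-1) f g

theorem HTensor.map_sub_left (f f' : H →L[ℂ] H') (g : K →L[ℂ] K') :
    HTensor.map (f - f') g = HTensor.map f g - HTensor.map f' g := by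
  rw [sub_eq_add_neg, HTensor.map_add_left, HTensor.map_neg_left, sub_eq_add_neg]

theorem HTensor.map_sub_right (f : H →L[ℂ] H') (g g' : K →L[ℂ] K') :
    HTensor.map f (g - g') = HTensor.map f g - HTensor.map f g' := by
  rw [sub_eq_add_neg, HTensor.map_add_right, HTensor.map_neg_right, sub_eq_add_neg]

theorem HTensor.adjoint_map [CompleteSpace H] [CompleteSpace K] [CompleteSpace H']
    [CompleteSpace K'] (f : H →L[ℂ] H') (g : K →L[ℂ] K') :
    (HTensor.map f g).adjoint = HTensor.map f.adjoint g.adjoint := by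
  refine HTensor.ext fun x y => ?_
  rw [← sub_eq_zero]
  refine HTensor.eq_zero_of_inner_tmul fun x' y' => ?_
  rw [inner_sub_left, ContinuousLinearMap.adjoint_inner_left, HTensor.map_tmul, HTensor.map_tmul,
    HTensor.inner_tmul, HTensor.inner_tmul, ContinuousLinearMap.adjoint_inner_left,
    ContinuousLinearMap.adjoint_inner_left, sub_self]

/-- Both factors are of the form `r† r`, and so is the tensor product. -/
theorem HTensor.isPositive_map [CompleteSpace H] [CompleteSpace K] {f : H →L[ℂ] H}
    {g : K →L[ℂ] K} (hf : f.IsPositive) (hg : g.IsPositive) : (HTensor.map f g).IsPositive := by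
  obtain ⟨r, hr⟩ := (CStarAlgebra.nonneg_iff_eq_star_mul_self (a := f)).mp
    ((ContinuousLinearMap.nonneg_iff_isPositive f).mpr hf)
  obtain ⟨s, hs⟩ := (CStarAlgebra.nonneg_iff_eq_star_mul_self (a := g)).mp
    ((ContinuousLinearMap.nonneg_iff_isPositive g).mpr hg)
  have : HTensor.map f g = (HTensor.map r s).adjoint ∘L HTensor.map r s := by
    rw [HTensor.adjoint_map, ← HTensor.map_comp, hr, hs]; rfl
  rw [this]
  exact ContinuousLinearMap.isPositive_adjoint_comp_self _

theorem adjoint_one_eq [CompleteSpace H] : (1 : H →L[ℂ] H).adjoint = 1 :=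
  star_one (H →L[ℂ] H)

/-- The bounded linear map `y ↦ x ⊗ y`. -/
def HTensor.tmulLeft (x : H) : K →L[ℂ] HTensor H K :=
  (HTensor.of : H ⊗[ℂ] K →ₗᵢ[ℂ] HTensor H K).toContinuousLinearMap ∘L
    (TensorProduct.mkL ℂ H K) x

theorem HTensor.tmulLeft_apply (x : H) (y : K) :
    HTensor.tmulLeft x y = HTensor.tmul x y := rfl

/-- If `X ⊗ 1` annihilates `v`, then `v` is supported on `ker X ⊗ K`: every slice
`(1 ⊗ ⟨y|) v` lies in the kernel of `X`. -/
theorem HTensor.map_starProjection_ker_left [CompleteSpace H] [CompleteSpace K]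
    (X : H →L[ℂ] H) {v : HTensor H K} (hv : HTensor.map X (1 : K →L[ℂ] K) v = 0) :
    HTensor.map (LinearMap.ker X.toLinearMap).starProjection (1 : K →L[ℂ] K) v = v := by
  set S := LinearMap.ker X.toLinearMap
  rw [← sub_eq_zero]
  have hslice : ∀ (T : H →L[ℂ] H) (y : K), (HTensor.tmulRight y).adjoint
      (HTensor.map T (1 : K →L[ℂ] K) v) = T ((HTensor.tmulRight y).adjoint v) := by
    intro T y
    refine ext_inner_left ℂ fun z => ?_
    rw [ContinuousLinearMap.adjoint_inner_right, ← ContinuousLinearMap.adjoint_inner_left,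
      HTensor.adjoint_map, HTensor.tmulRight_apply, HTensor.map_tmul,
      ← ContinuousLinearMap.adjoint_inner_left T, ContinuousLinearMap.adjoint_inner_right]
    simp [HTensor.tmulRight_apply, adjoint_one_eq]
  refine HTensor.eq_zero_of_inner_tmul fun x y => ?_
  rw [← HTensor.tmulRight_apply, ← ContinuousLinearMap.adjoint_inner_left, map_sub, hslice]
  have : (HTensor.tmulRight y).adjoint v ∈ S := by
    rw [LinearMap.mem_ker]
    change X _ = 0
    rw [← hslice, hv, map_zero]
  rw [Submodule.starProjection_eq_self_iff.mpr this, sub_self, inner_zero_left]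

theorem HTensor.map_starProjection_ker_right [CompleteSpace H] [CompleteSpace K]
    (X : K →L[ℂ] K) {v : HTensor H K} (hv : HTensor.map (1 : H →L[ℂ] H) X v = 0) :
    HTensor.map (1 : H →L[ℂ] H) (LinearMap.ker X.toLinearMap).starProjection v = v := by
  set S := LinearMap.ker X.toLinearMap
  rw [← sub_eq_zero]
  have hslice : ∀ (T : K →L[ℂ] K) (x : H), (HTensor.tmulLeft x).adjoint
      (HTensor.map (1 : H →L[ℂ] H) T v) = T ((HTensor.tmulLeft x).adjoint v) := by
    intro T x
    refine ext_inner_left ℂ fun z => ?_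
    rw [ContinuousLinearMap.adjoint_inner_right, ← ContinuousLinearMap.adjoint_inner_left,
      HTensor.adjoint_map, HTensor.tmulLeft_apply, HTensor.map_tmul,
      ← ContinuousLinearMap.adjoint_inner_left T, ContinuousLinearMap.adjoint_inner_right]
    simp [HTensor.tmulLeft_apply, adjoint_one_eq]
  refine HTensor.eq_zero_of_inner_tmul fun x y => ?_
  rw [← HTensor.tmulLeft_apply, ← ContinuousLinearMap.adjoint_inner_left, map_sub, hslice]
  have : (HTensor.tmulLeft x).adjoint v ∈ S := by
    rw [LinearMap.mem_ker]
    change X _ = 0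
    rw [← hslice, hv, map_zero]
  rw [Submodule.starProjection_eq_self_iff.mpr this, sub_self, inner_zero_left]

/-! ### Attaching a qubit -/

/-- The isometric copy `h ↦ h ⊗ |i⟩` of `H` in `H ⊗ ℂ²`. -/
def slot (i : Fin 2) : H →L[ℂ] HTensor H Qubit := HTensor.tmulRight (ket i)

theorem inner_ket (i j : Fin 2) : inner ℂ (ket i) (ket j) = if i = j then (1 : ℂ) else 0 := by
  simp [ket, EuclideanSpace.inner_single_left]

theorem inner_slot (i j : Fin 2) (h h' : H) :
    inner ℂ (slot i h) (slot j h') = if i = j then inner ℂ h h' else 0 := by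
  rw [slot, slot, HTensor.tmulRight_apply, HTensor.tmulRight_apply, HTensor.inner_tmul, inner_ket]
  split_ifs <;> simp

theorem adjoint_slot_slot [CompleteSpace H] (i j : Fin 2) (h : H) :
    (slot i).adjoint (slot j h) = if i = j then h else 0 := by
  refine ext_inner_left ℂ fun z => ?_
  rw [ContinuousLinearMap.adjoint_inner_right, inner_slot]
  split_ifs <;> simp

theorem norm_slot (i : Fin 2) (h : H) : ‖slot i h‖ = ‖h‖ := by
  rw [@norm_eq_sqrt_re_inner ℂ, @norm_eq_sqrt_re_inner ℂ H, inner_slot, if_pos rfl]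

/-- `slot i` as a linear isometry. -/
def slotIsometry (i : Fin 2) : H →ₗᵢ[ℂ] HTensor H Qubit where
  toLinearMap := (slot i).toLinearMap
  norm_map' := norm_slot i

end HTensorAlgebra

/-! ### The sum of squares and its equality case -/

section SumOfSquares

variable {V : Type*} [NormedAddCommGroup V] [InnerProductSpace ℂ V]

/-- Self-adjoint idempotents `P`, `F` (Alice) and `G` (Bob) and a self-adjoint involution `B`
(Bob) on one Hilbert space, Alice's operators commuting with Bob's. For a strategy, `P` is Alice's
effect of the outcome `1` for the setting `0`, `F` her effect of the outcome `0` for the setting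
`1`, `G` Bob's effect of the outcome `0` for the setting `0`, and `B` the negative of his
observable for the setting `1`. -/
structure IsCHSHAlgebra (P F G B : V →L[ℂ] V) : Prop where
  inner_P : ∀ u v, inner ℂ (P u) v = inner ℂ u (P v)
  inner_F : ∀ u v, inner ℂ (F u) v = inner ℂ u (F v)
  inner_G : ∀ u v, inner ℂ (G u) v = inner ℂ u (G v)
  inner_B : ∀ u v, inner ℂ (B u) v = inner ℂ u (B v)
  P_P : ∀ v, P (P v) = P v
  F_F : ∀ v, F (F v) = F v
  G_G : ∀ v, G (G v) = G v
  B_B : ∀ v, B (B v) = v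
  P_G : ∀ v, P (G v) = G (P v)
  F_G : ∀ v, F (G v) = G (F v)
  P_B : ∀ v, P (B v) = B (P v)
  F_B : ∀ v, F (B v) = B (F v)

namespace IsCHSHAlgebra

variable {P F G B : V →L[ℂ] V} (h : IsCHSHAlgebra P F G B)
include h

/-- The symmetry that exchanges the roles of `x = G ψ` and `y = (1 - G) ψ`. -/
theorem symm : IsCHSHAlgebra F P (1 - G) B := by
  constructor
  all_goals intros
  all_goals simp [h.inner_P, h.inner_F, h.inner_G, h.inner_B, h.P_P, h.F_F, h.G_G, h.B_B,
    h.P_G, h.F_G, h.P_B, h.F_B]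

/-- The sum-of-squares certificate. In a pair of Jordan blocks in which the ranges of `P` and `F`
meet at overlap `-c` and `B` is `[[z, r], [r, -z]]` in the eigenbasis of `G`, the identity is
`(1 - 2 c r X + 2 c² z Z)² + 4 c² (1 - c²) z² = 1 + 4 c² (1 + z Z) - 4 c r X`. -/
theorem sum_of_squares {x y : V} (hGx : G x = x) (hGy : G y = 0) (hPx : P x = x) (hFy : F y = y) :
    ‖x + (2 : ℂ) • G (B (P (y + F x)))‖ ^ 2
      + ‖y + (2 : ℂ) • (1 - G) (B (F (x + P y)))‖ ^ 2
      + 4 * ‖G (B (F x - P (F x)))‖ ^ 2 + 4 * ‖(1 - G) (B (P y - F (P y)))‖ ^ 2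
    = ‖x + y‖ ^ 2 - 4 * (inner ℂ (x + y)
        ((x + y) - P (x + y) - F (x + y) + B ((x + y) - P (x + y) - F (x + y)))).re := by
  have hx : ∀ w, inner ℂ x (P w) = inner ℂ x w := fun w => by rw [← h.inner_P, hPx]
  have hy : ∀ w, inner ℂ y (F w) = inner ℂ y w := fun w => by rw [← h.inner_F, hFy]
  have hxG : ∀ w, inner ℂ x (G w) = inner ℂ x w := fun w => by rw [← h.inner_G, hGx]
  have hyG : ∀ w, inner ℂ y (G w) = 0 := fun w => by rw [← h.inner_G, hGy, inner_zero_left]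
  have hxB : ∀ w, inner ℂ x (B (P w)) = inner ℂ x (B w) := fun w => by rw [← h.P_B, hx]
  have hyB : ∀ w, inner ℂ y (B (F w)) = inner ℂ y (B w) := fun w => by rw [← h.F_B, hy]
  have hxy : inner ℂ x y = 0 := by rw [← hGx, h.inner_G, hGy, inner_zero_right]
  have hyx : inner ℂ y x = 0 := inner_eq_zero_symm.mp hxy
  have hxyP : ∀ w, G w = 0 → inner ℂ x w = 0 := fun w hw => by rw [← hxG, hw, inner_zero_right]
  have hyxP : ∀ w, G w = w → inner ℂ y w = 0 := fun w hw => by rw [← hw, hyG]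
  have e2 : inner ℂ x (F (P y)) = 0 := hxyP _ (by rw [← h.F_G, ← h.P_G, hGy]; simp)
  have e3 : inner ℂ y (P (F x)) = 0 := hyxP _ (by rw [← h.P_G, ← h.F_G, hGx])
  -- All words are brought to the form: Bob's letters outside, Alice's inside.
  have key : inner ℂ (x + (2 : ℂ) • G (B (P (y + F x)))) (x + (2 : ℂ) • G (B (P (y + F x))))
      + inner ℂ (y + (2 : ℂ) • (1 - G) (B (F (x + P y)))) (y + (2 : ℂ) • (1 - G) (B (F (x + P y))))
      + 4 * inner ℂ (G (B (F x - P (F x)))) (G (B (F x - P (F x))))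
      + 4 * inner ℂ ((1 - G) (B (P y - F (P y)))) ((1 - G) (B (P y - F (P y))))
      = inner ℂ (x + y) (x + y) - 4 * (inner ℂ (x + y)
        ((x + y) - P (x + y) - F (x + y) + B ((x + y) - P (x + y) - F (x + y)))) := by
    simp only [map_add, map_sub, sub_apply, one_apply_eq_self, inner_add_left,
      inner_add_right, inner_sub_left, inner_sub_right, inner_smul_left, inner_smul_right,
      h.inner_P, h.inner_F, h.inner_G, h.inner_B, h.P_P, h.F_F, h.G_G, h.B_B, h.P_G, h.F_G, h.P_B,
      h.F_B, hx, hy, hxG, hyG, hxB, hyB, hPx, hFy, hGx, hGy, map_zero, inner_zero_right,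
      hxy, hyx, map_ofNat, e2, e3]
    ring
  have hn : ∀ v : V, inner ℂ v v = ((‖v‖ ^ 2 : ℝ) : ℂ) := fun v => by
    rw [inner_self_eq_norm_sq_to_K]; norm_cast
  have h4 : ∀ z : ℂ, (4 * z).re = 4 * z.re := fun z => by simp
  simp only [hn] at key
  simpa only [Complex.add_re, Complex.sub_re, Complex.ofReal_re, h4]
    using congrArg Complex.re key

/-- When the squares vanish, `B` has no diagonal part on `x`. The vector `η = G B x` is first shown
to be fixed by both `P` and `F`; on the common fixed space of these the equations lose Alice's
operators and become `(1 + 2 B) (x + y) = 0`, where `1 + 2 B` is invertible. -/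
theorem compression_eq_zero {x y : V} (hGx : G x = x) (hGy : G y = 0) (hPx : P x = x)
    (hFy : F y = y)
    (h1 : x + (2 : ℂ) • G (B (P (y + F x))) = 0)
    (h2 : y + (2 : ℂ) • (1 - G) (B (F (x + P y))) = 0)
    (h3 : G (B (F x - P (F x))) = 0) : G (B x) = 0 := by
  set η := G (B x) with hη
  have hPη : P η = η := by rw [hη, h.P_G, h.P_B, hPx]
  have hFη : F η = G (B (F x)) := by rw [hη, h.F_G, h.F_B]
  have hPFη : P (F η) = F η := by
    rw [hFη, h.P_G, h.P_B]
    rw [map_sub, map_sub, sub_eq_zero] at h3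
    exact h3.symm
  have hη1 : η = -((2 : ℂ) • G (B (G (B (P (y + F x)))))) := by
    rw [hη]
    nth_rewrite 1 [eq_neg_of_add_eq_zero_left h1]
    simp only [map_neg, map_smul]
  have hFd : F (η - F η) = 0 := by rw [map_sub, h.F_F, sub_self]
  have hPd : P (η - F η) = η - F η := by rw [map_sub, hPη, hPFη]
  have hd0 : ∀ w, inner ℂ (η - F η) (F w) = 0 := fun w => by
    rw [← h.inner_F, hFd, inner_zero_left]
  have hdη : inner ℂ (η - F η) η = 0 := by
    have : inner ℂ (η - F η) η
        = inner ℂ (η - F η) (-((2 : ℂ) • G (B (G (B (P (y + F x))))))) := by rw [← hη1]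
    rw [this, inner_neg_right, inner_smul_right, ← h.P_B, ← h.P_G, ← h.P_B, ← h.P_G,
      ← h.inner_P, hPd]
    have hF : G (B (G (B (y + F x)))) = F (G (B (G (B (y + x))))) := by
      rw [h.F_G, h.F_B, h.F_G, h.F_B, map_add F, hFy]
    rw [hF, hd0, mul_zero, neg_zero]
  have hη2 : F η = η := by
    have : inner ℂ (η - F η) (η - F η) = 0 := by
      rw [inner_sub_right, hdη, hd0, sub_zero]
    exact (sub_eq_zero.mp (inner_self_eq_zero.mp this)).symm
  have hW : ∀ u, P u = u → F u = u →
      inner ℂ u (x + y) + 2 * inner ℂ u (B (x + y)) = 0 := by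
    intro u hPu hFu
    have hp : ∀ w, inner ℂ u (P w) = inner ℂ u w := fun w => by rw [← h.inner_P, hPu]
    have hf : ∀ w, inner ℂ u (F w) = inner ℂ u w := fun w => by rw [← h.inner_F, hFu]
    have e1 := congrArg (inner ℂ u) h1
    have e2 := congrArg (inner ℂ u) h2
    rw [inner_add_right, inner_smul_right, ← h.P_B, ← h.P_G, hp, map_add, ← h.F_B, map_add,
      ← h.F_G, inner_add_right, hf, inner_zero_right] at e1
    rw [inner_add_right, inner_smul_right, ← h.F_B, ← h.symm.P_G, hf, map_add, ← h.P_B, map_add,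
      ← h.symm.F_G, inner_add_right, hp, inner_zero_right] at e2
    simp only [sub_apply, one_apply_eq_self, inner_sub_right] at e2
    simp only [map_add, inner_add_right]
    linear_combination e1 + e2
  -- `(1 + 2 B) (2 B - 1) = 3`, so that `u = (2 B - 1) G B η` isolates `⟪G B η, x + y⟫`.
  have hlast := hW ((2 : ℂ) • B (G (B η)) - G (B η))
    (by simp only [map_sub, map_smul, h.P_B, h.P_G, hPη])
    (by simp only [map_sub, map_smul, h.F_B, h.F_G, hη2])
  have hGη : inner ℂ (G (B η)) (x + y) = inner ℂ η η := by
    have hGG : G η = η := by rw [hη, h.G_G]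
    rw [h.inner_G, h.inner_B, map_add, hGx, hGy, add_zero]
    nth_rewrite 1 [← hGG]
    rw [h.inner_G]
  rw [inner_sub_left, inner_sub_left, inner_smul_left, inner_smul_left, ← h.inner_B, ← h.inner_B,
    h.B_B, hGη, map_ofNat] at hlast
  refine inner_self_eq_zero (𝕜 := ℂ).mp ?_
  linear_combination hlast / 3

/-- The relations that make the span of `x`, `y`, `B x`, `B y` invariant under all four
operators. -/
theorem relations {x y : V} (hGx : G x = x) (hGy : G y = 0) (hPx : P x = x) (hFy : F y = y)
    (h1 : x + (2 : ℂ) • G (B (P (y + F x))) = 0)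
    (h2 : y + (2 : ℂ) • (1 - G) (B (F (x + P y))) = 0)
    (h3 : G (B (F x - P (F x))) = 0) (h4 : (1 - G) (B (P y - F (P y))) = 0) :
    G (B x) = 0 ∧ G (B y) = B y ∧ B x = (-2 : ℂ) • P y ∧ B y = (-2 : ℂ) • F x ∧
      ‖x‖ = ‖y‖ := by
  have hGx' : (1 - G) x = 0 := by simp [hGx]
  have hGy' : (1 - G) y = y := by simp [hGy]
  have e1 : G (B x) = 0 := h.compression_eq_zero hGx hGy hPx hFy h1 h2 h3
  have e2 : (1 - G) (B y) = 0 := h.symm.compression_eq_zero hGy' hGx' hFy hPx h2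
    (by simpa using h1) h4
  have e2' : G (B y) = B y := by
    rw [sub_apply, sub_eq_zero] at e2; exact e2.symm
  have b1 : B x = (-2 : ℂ) • P y := by
    have : G (B (P (y + F x))) = B (P y) := by
      rw [map_sub, map_sub, sub_eq_zero] at h3
      rw [map_add, map_add, map_add, ← h3, ← h.F_B, ← h.F_G, e1, map_zero, add_zero, ← h.P_B,
        ← h.P_G, e2']
    rw [this] at h1
    rw [eq_neg_of_add_eq_zero_left h1, map_neg, map_smul, h.B_B, neg_smul]
  have b2 : B y = (-2 : ℂ) • F x := by
    have : (1 - G) (B (F (x + P y))) = B (F x) := by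
      rw [map_sub, map_sub, sub_eq_zero] at h4
      rw [map_add, map_add, map_add, ← h4, ← h.P_B, ← h.symm.F_G, e2, map_zero, add_zero, ← h.F_B,
        sub_apply, ← h.F_G, e1]
      simp
    rw [this] at h2
    rw [eq_neg_of_add_eq_zero_left h2, map_neg, map_smul, h.B_B, neg_smul]
  refine ⟨e1, e2', b1, b2, ?_⟩
  have i1 : inner ℂ x x = -2 * inner ℂ (B x) y := by
    have : inner ℂ x x = inner ℂ (B x) (B x) := by rw [h.inner_B, h.B_B]
    rw [this]
    nth_rewrite 2 [b1]
    rw [inner_smul_right, ← h.inner_P, h.P_B, hPx]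
  have i2 : inner ℂ y y = -2 * inner ℂ (B x) y := by
    have : inner ℂ y y = inner ℂ (B y) (B y) := by rw [h.inner_B, h.B_B]
    rw [this]
    nth_rewrite 1 [b2]
    rw [inner_smul_left, h.inner_F, h.F_B, hFy, h.inner_B, map_neg, map_ofNat]
  rw [@norm_eq_sqrt_re_inner ℂ, @norm_eq_sqrt_re_inner ℂ V _ _ _ y, i1, i2]

end IsCHSHAlgebra
end SumOfSquares

/-! ### Local isometries from swap operators -/

section SwapIsometry

variable {H : Type} [NormedAddCommGroup H] [InnerProductSpace ℂ H] [CompleteSpace H]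

/-- The subspace on which `v ↦ ∑ i, W i v ⊗ |i⟩` is an isometry in the strong sense that
`∑ i, (W i)† W i` acts as the identity. -/
def swapDomain (W : Fin 2 → H →L[ℂ] H) : Submodule ℂ H :=
  LinearMap.ker (1 - ∑ i, (W i).adjoint ∘L W i : H →L[ℂ] H).toLinearMap

instance (W : Fin 2 → H →L[ℂ] H) : (swapDomain W).HasOrthogonalProjection :=
  inferInstanceAs (LinearMap.ker
    (1 - ∑ i, (W i).adjoint ∘L W i : H →L[ℂ] H).toLinearMap).HasOrthogonalProjection

/-- The map `v ↦ ∑ i, W i v ⊗ |i⟩` on `swapDomain W` extends to an isometry of the whole space: the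
orthogonal complement is sent to a second copy of `H` inside `H ⊗ ℂ²`. -/
theorem exists_isometry_extending_swap (W : Fin 2 → H →L[ℂ] H) :
    ∃ Φ : H →ₗᵢ[ℂ] HTensor (HTensor H Qubit) Qubit,
      Φ.toContinuousLinearMap ∘L (swapDomain W).starProjection
        = (∑ i, slot i ∘L slot 0 ∘L W i) ∘L (swapDomain W).starProjection := by
  let S := swapDomain W
  let Ψ : H →L[ℂ] HTensor (HTensor H Qubit) Qubit :=
    (∑ i, slot i ∘L slot 0 ∘L W i) ∘L S.starProjection
      + slot 0 ∘L slot 1 ∘L (1 - S.starProjection)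
  have hΨ : ∀ v, ‖Ψ v‖ = ‖v‖ := by
    intro v
    have hs : ‖W 0 (S.starProjection v)‖ ^ 2 + ‖W 1 (S.starProjection v)‖ ^ 2
        = ‖S.starProjection v‖ ^ 2 := by
      have hm : S.starProjection v ∈ S := Submodule.starProjection_apply_mem S v
      have hm := LinearMap.mem_ker.mp hm
      have hm' : S.starProjection v = (W 0).adjoint (W 0 (S.starProjection v))
          + (W 1).adjoint (W 1 (S.starProjection v)) := by
        simpa [sub_eq_zero] using hm
      have : inner ℂ (S.starProjection v) (S.starProjection v)
          = inner ℂ (W 0 (S.starProjection v)) (W 0 (S.starProjection v))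
            + inner ℂ (W 1 (S.starProjection v)) (W 1 (S.starProjection v)) := by
        nth_rewrite 2 [hm']
        rw [inner_add_right, ContinuousLinearMap.adjoint_inner_right,
          ContinuousLinearMap.adjoint_inner_right]
      simp only [inner_self_eq_norm_sq_to_K] at this
      exact_mod_cast this.symm
    have ho : ‖S.starProjection v‖ ^ 2 + ‖v - S.starProjection v‖ ^ 2 = ‖v‖ ^ 2 := by
      have := Submodule.norm_sq_eq_add_norm_sq_starProjection v S
      rw [Submodule.starProjection_orthogonal_val] at this
      exact this.symm
    have hn : ‖Ψ v‖ ^ 2 = ‖v‖ ^ 2 := by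
      have : inner ℂ (Ψ v) (Ψ v)
          = inner ℂ (W 0 (S.starProjection v)) (W 0 (S.starProjection v))
            + inner ℂ (W 1 (S.starProjection v)) (W 1 (S.starProjection v))
            + inner ℂ (v - S.starProjection v) (v - S.starProjection v) := by
        simp only [Ψ, Fin.sum_univ_two, add_apply, ContinuousLinearMap.comp_apply, sub_apply,
          one_apply_eq_self, inner_add_left, inner_add_right, inner_slot]
        simp
      simp only [inner_self_eq_norm_sq_to_K] at this
      rw [← ho, ← hs]
      exact_mod_cast this
    exact (sq_eq_sq₀ (norm_nonneg _) (norm_nonneg _)).mp hn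
  refine ⟨⟨Ψ.toLinearMap, hΨ⟩, ?_⟩
  ext v
  have hi : S.starProjection (S.starProjection v) = S.starProjection v :=
    Submodule.starProjection_eq_self_iff.mpr (Submodule.starProjection_apply_mem S v)
  change Ψ (S.starProjection v) = _
  simp only [Ψ, add_apply, ContinuousLinearMap.comp_apply, sub_apply, one_apply_eq_self, hi,
    sub_self, map_zero, add_zero]
  rfl

end SwapIsometry

section LocalReduction

variable {HA HB : Type} [NormedAddCommGroup HA] [InnerProductSpace ℂ HA] [CompleteSpace HA]
  [NormedAddCommGroup HB] [InnerProductSpace ℂ HB] [CompleteSpace HB]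

omit [CompleteSpace HA] [CompleteSpace HB] in
theorem HTensor.attach_ket (i j : Fin 2) (v : HTensor HA HB) :
    HTensor.attach (ket i ⊗ₜ[ℂ] ket j) v = HTensor.map (slot i) (slot j) v := by
  rw [HTensor.attach, TensorProduct.lift.tmul]; rfl

/-- Swap operators `W` for Alice and `Y` for Bob extract the reference strategy if, on the state,
they carry the measurements to the matrices `m`, `n` of the reference measurements, and
`W k ⊗ Y l` produces the amplitude `t k l` of the reference state times one fixed vector `ς`. -/
theorem locallyReducesTo_of_swap {ψ : HTensor HA HB} {M : Fin 2 → Povm HA} {N : Fin 2 → Povm HB}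
    {ψ' : Qubit ⊗[ℂ] Qubit} {M' N' : Fin 2 → Povm Qubit}
    (W : Fin 2 → HA →L[ℂ] HA) (Y : Fin 2 → HB →L[ℂ] HB) (ς : HTensor HA HB) (hς : ‖ς‖ = 1)
    (m n : Fin 2 → Fin 2 → Matrix (Fin 2) (Fin 2) ℂ) (t : Matrix (Fin 2) (Fin 2) ℂ)
    (hM' : ∀ a x k, (M' x).effect a (ket k) = ∑ i, m a x i k • ket i)
    (hN' : ∀ b y l, (N' y).effect b (ket l) = ∑ j, n b y j l • ket j)
    (hψ' : ψ' = ∑ k, ∑ l, t k l • ket k ⊗ₜ[ℂ] ket l)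
    (hWS : ∀ a x, HTensor.map (∑ i, (W i).adjoint ∘L W i) (1 : HB →L[ℂ] HB)
      (HTensor.map ((M x).effect a) 1 ψ)
      = HTensor.map ((M x).effect a) 1 ψ)
    (hYS : ∀ b y, HTensor.map (1 : HA →L[ℂ] HA) (∑ j, (Y j).adjoint ∘L Y j)
      (HTensor.map 1 ((N y).effect b) ψ)
      = HTensor.map 1 ((N y).effect b) ψ)
    (hW : ∀ i a x, HTensor.map (W i) (1 : HB →L[ℂ] HB) (HTensor.map ((M x).effect a) 1 ψ)
      = ∑ k, m a x i k • HTensor.map (W k) 1 ψ)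
    (hY : ∀ j b y, HTensor.map (1 : HA →L[ℂ] HA) (Y j) (HTensor.map 1 ((N y).effect b) ψ)
      = ∑ l, n b y j l • HTensor.map 1 (Y l) ψ)
    (ht : ∀ k l, HTensor.map (W k) (Y l) ψ = t k l • ς) :
    LocallyReducesTo ψ M N ψ' M' N' := by
  obtain ⟨ΦA, hA⟩ := exists_isometry_extending_swap W
  obtain ⟨ΦB, hB⟩ := exists_isometry_extending_swap Y
  set SA := swapDomain W
  set SB := swapDomain Y
  have hπ : ∀ a b x y, HTensor.map SA.starProjection SB.starProjection
      (HTensor.map ((M x).effect a) ((N y).effect b) ψ)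
        = HTensor.map ((M x).effect a) ((N y).effect b) ψ := by
    intro a b x y
    have h1 : HTensor.map SA.starProjection (1 : HB →L[ℂ] HB) (HTensor.map ((M x).effect a) 1 ψ)
        = HTensor.map ((M x).effect a) 1 ψ := by
      apply HTensor.map_starProjection_ker_left
      rw [HTensor.map_sub_left, HTensor.map_one, sub_apply, hWS, one_apply_eq_self, sub_self]
    have h2 : HTensor.map (1 : HA →L[ℂ] HA) SB.starProjection (HTensor.map 1 ((N y).effect b) ψ)
        = HTensor.map 1 ((N y).effect b) ψ := by
      apply HTensor.map_starProjection_ker_right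
      rw [HTensor.map_sub_right, HTensor.map_one, sub_apply, hYS, one_apply_eq_self, sub_self]
    have e1 : HTensor.map SA.starProjection SB.starProjection
        (HTensor.map ((M x).effect a) ((N y).effect b) ψ)
        = HTensor.map (1 : HA →L[ℂ] HA) (SB.starProjection ∘L (N y).effect b)
          (HTensor.map SA.starProjection (1 : HB →L[ℂ] HB) (HTensor.map ((M x).effect a) 1 ψ)) := by
      simp only [HTensor.map_map]; rfl
    have e2 : HTensor.map (1 : HA →L[ℂ] HA) (SB.starProjection ∘L (N y).effect b)
          (HTensor.map ((M x).effect a) (1 : HB →L[ℂ] HB) ψ) = HTensor.map ((M x).effect a) 1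
          (HTensor.map (1 : HA →L[ℂ] HA) SB.starProjection (HTensor.map 1 ((N y).effect b) ψ)) := by
      simp only [HTensor.map_map]; rfl
    rw [e1, h1, e2, h2, HTensor.map_map]; rfl
  refine ⟨HTensor HA Qubit, HTensor HB Qubit, inferInstance, inferInstance, inferInstance,
    inferInstance, inferInstance, inferInstance, ΦA, ΦB, HTensor.map (slot 0) (slot 0) ς, ?_, ?_⟩
  · have : inner ℂ (HTensor.map (slot (H := HA) 0) (slot (H := HB) 0) ς)
        (HTensor.map (slot 0) (slot 0) ς) = inner ℂ ς ς := by
      have hs : ∀ (H : Type) [NormedAddCommGroup H] [InnerProductSpace ℂ H] [CompleteSpace H],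
          (slot (H := H) 0).adjoint ∘L slot 0 = 1 := fun H _ _ _ => by
        ext v; simp [adjoint_slot_slot]
      rw [← ContinuousLinearMap.adjoint_inner_right, HTensor.adjoint_map, HTensor.map_map, hs, hs,
        HTensor.map_one, one_apply_eq_self]
    rw [@norm_eq_sqrt_re_inner ℂ, this, ← @norm_eq_sqrt_re_inner ℂ, hς]
  · intro a b x y
    rw [← hπ, HTensor.map_map, hA, hB, HTensor.map_comp, ContinuousLinearMap.comp_apply, hπ, hψ']
    have key : ∀ i j, HTensor.map (W i) (Y j) (HTensor.map ((M x).effect a) ((N y).effect b) ψ)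
        = ∑ k, ∑ l, (m a x i k * n b y j l * t k l) • ς := by
      intro i j
      have e1 : HTensor.map (W i) (Y j) (HTensor.map ((M x).effect a) ((N y).effect b) ψ)
          = HTensor.map (1 : HA →L[ℂ] HA) (Y j ∘L (N y).effect b)
            (HTensor.map (W i) (1 : HB →L[ℂ] HB) (HTensor.map ((M x).effect a) 1 ψ)) := by
        simp only [HTensor.map_map]; rfl
      have e2 : ∀ k, HTensor.map (1 : HA →L[ℂ] HA) (Y j ∘L (N y).effect b)
            (HTensor.map (W k) (1 : HB →L[ℂ] HB) ψ)
          = HTensor.map (W k) (1 : HB →L[ℂ] HB)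
            (HTensor.map (1 : HA →L[ℂ] HA) (Y j) (HTensor.map 1 ((N y).effect b) ψ)) := by
        intro k
        simp only [HTensor.map_map]; rfl
      have e3 : ∀ k l, HTensor.map (W k) (1 : HB →L[ℂ] HB) (HTensor.map 1 (Y l) ψ)
          = t k l • ς := by
        intro k l
        rw [HTensor.map_map, ← ht]; rfl
      rw [e1, hW, map_sum]
      refine Finset.sum_congr rfl fun k _ => ?_
      rw [map_smul, e2, hY, map_sum, Finset.smul_sum]
      refine Finset.sum_congr rfl fun l _ => ?_
      rw [map_smul, e3, smul_smul, smul_smul, mul_assoc]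
    simp only [Fin.sum_univ_two] at key ⊢
    simp only [HTensor.map_add_left, HTensor.map_add_right, HTensor.map_comp, add_apply,
      ContinuousLinearMap.comp_apply, key, map_add, map_smul, TensorProduct.mapL_tmul, hM', hN',
      Fin.sum_univ_two, TensorProduct.add_tmul, TensorProduct.tmul_add,
      ← TensorProduct.smul_tmul', TensorProduct.tmul_smul, HTensor.attach_ket, smul_apply]
    module

end LocalReduction

/-! ### Correlations of pure-state strategies -/

section Correlations

variable {HA HB : Type} [NormedAddCommGroup HA] [InnerProductSpace ℂ HA]
  [NormedAddCommGroup HB] [InnerProductSpace ℂ HB]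

theorem Povm.effect_one_eq {H : Type} [NormedAddCommGroup H] [InnerProductSpace ℂ H]
    (M : Povm H) : M.effect 1 = 1 - M.effect 0 :=
  eq_sub_of_add_eq' M.sum_eq_one

theorem Realizes.sum_right {P : Correlation} {ψ : HTensor HA HB} {M : Fin 2 → Povm HA}
    {N : Fin 2 → Povm HB} (h : Realizes P ψ M N) (a x y : Fin 2) :
    P a 0 x y + P a 1 x y
      = (inner ℂ ψ (HTensor.map ((M x).effect a) (1 : HB →L[ℂ] HB) ψ)).re := by
  have : ((P a 0 x y + P a 1 x y : ℝ) : ℂ)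
      = inner ℂ ψ (HTensor.map ((M x).effect a) (1 : HB →L[ℂ] HB) ψ) := by
    rw [Complex.ofReal_add, ← h.2, ← h.2, ← inner_add_right, ← add_apply, ← HTensor.map_add_right,
      (N y).sum_eq_one]
  rw [← this, Complex.ofReal_re]

theorem Realizes.sum_left {P : Correlation} {ψ : HTensor HA HB} {M : Fin 2 → Povm HA}
    {N : Fin 2 → Povm HB} (h : Realizes P ψ M N) (b x y : Fin 2) :
    P 0 b x y + P 1 b x y
      = (inner ℂ ψ (HTensor.map (1 : HA →L[ℂ] HA) ((N y).effect b) ψ)).re := by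
  have : ((P 0 b x y + P 1 b x y : ℝ) : ℂ)
      = inner ℂ ψ (HTensor.map (1 : HA →L[ℂ] HA) ((N y).effect b) ψ) := by
    rw [Complex.ofReal_add, ← h.2, ← h.2, ← inner_add_right, ← add_apply, ← HTensor.map_add_left,
      (M x).sum_eq_one]
  rw [← this, Complex.ofReal_re]

theorem Realizes.sum_all {P : Correlation} {ψ : HTensor HA HB} {M : Fin 2 → Povm HA}
    {N : Fin 2 → Povm HB} (h : Realizes P ψ M N) (x y : Fin 2) :
    P 0 0 x y + P 0 1 x y + (P 1 0 x y + P 1 1 x y) = 1 := by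
  rw [h.sum_right, h.sum_right, ← Complex.add_re, ← inner_add_right, ← add_apply,
    ← HTensor.map_add_left, (M x).sum_eq_one, HTensor.map_one, one_apply_eq_self,
    inner_self_eq_norm_sq_to_K, h.1]
  simp

theorem chshValue_eq (P : Correlation) : chshValue P
    = -(P 0 0 0 0 + P 1 1 0 0 - P 0 1 0 0 - P 1 0 0 0)
      - (P 0 0 0 1 + P 1 1 0 1 - P 0 1 0 1 - P 1 0 0 1)
      - (P 0 0 1 0 + P 1 1 1 0 - P 0 1 1 0 - P 1 0 1 0)
      + (P 0 0 1 1 + P 1 1 1 1 - P 0 1 1 1 - P 1 0 1 1) := by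
  simp only [chshValue, Fin.sum_univ_two]
  norm_num
  ring

/-- Normalization, no-signalling and the two zeros leave only `P(0,1|0,1) - P(0,1|1,1)` free in the
CHSH value. -/
theorem Realizes.chshValue_of_zeros {P : Correlation} {ψ : HTensor HA HB} {M : Fin 2 → Povm HA}
    {N : Fin 2 → Povm HB} (h : Realizes P ψ M N) (h0 : P 0 0 0 0 = 0) (h1 : P 1 1 1 0 = 0) :
    chshValue P = 2 + 4 * (P 0 1 0 1 - P 0 1 1 1) := by
  rw [chshValue_eq]
  have r := fun a x => (h.sum_right a x 0).trans (h.sum_right a x 1).symm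
  have l := fun b y => (h.sum_left b 0 y).trans (h.sum_left b 1 y).symm
  have s := h.sum_all
  linarith [r 0 0, r 0 1, r 1 0, r 1 1, l 0 0, l 0 1, l 1 0, l 1 1, s 0 0, s 0 1, s 1 0, s 1 1]

theorem Realizes.nonneg [CompleteSpace HA] [CompleteSpace HB] {P : Correlation}
    {ψ : HTensor HA HB} {M : Fin 2 → Povm HA}
    {N : Fin 2 → Povm HB} (h : Realizes P ψ M N) (a b x y : Fin 2) : 0 ≤ P a b x y := by
  have := (HTensor.isPositive_map ((M x).isPositive a) ((N y).isPositive b)).re_inner_nonneg_right ψ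
  rw [h.2] at this
  simpa using this

end Correlations

/-! ### The reference strategy -/

section Reference

theorem toEuclideanCLM_ket (A : Matrix (Fin 2) (Fin 2) ℂ) (k : Fin 2) :
    Matrix.toEuclideanCLM (n := Fin 2) (𝕜 := ℂ) A (ket k) = ∑ i, A i k • ket i := by
  ext j
  rw [Matrix.ofLp_toEuclideanCLM]
  fin_cases j <;> fin_cases k <;> simp [ket, Matrix.mulVec, dotProduct]

/-- The matrices of the measurements `refMeasurement t`. -/
def refMatrix (t : ℝ) (a x : Fin 2) : Matrix (Fin 2) (Fin 2) ℂ :=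
  observableEffect (if x = 0 then pauliZ else rotObservable t) a

theorem refMeasurement_ket (t : ℝ) (a x k : Fin 2) :
    (refMeasurement t x).effect a (ket k) = ∑ i, refMatrix t a x i k • ket i := by
  rw [refMeasurement, refMatrix]
  split_ifs with hx
  all_goals exact toEuclideanCLM_ket _ _

theorem refMatrix_zero_zero (t : ℝ) : refMatrix t 0 0 = !![1, 0; 0, 0] := by
  ext i j
  fin_cases i <;> fin_cases j <;> norm_num [refMatrix, observableEffect, pauliZ]

theorem refMatrix_one (t : ℝ) (x : Fin 2) : refMatrix t 1 x = 1 - refMatrix t 0 x := by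
  rw [refMatrix, refMatrix]
  generalize (if x = 0 then pauliZ else rotObservable t) = A
  ext i j
  simp [observableEffect]
  ring

theorem refMatrix_alice : refMatrix (Real.pi / 6) 0 1
    = !![3 / 4, -((√3 : ℝ) : ℂ) / 4; -((√3 : ℝ) : ℂ) / 4, 1 / 4] := by
  have h : 2 * (Real.pi / 6) = Real.pi / 3 := by ring
  ext i j
  fin_cases i <;> fin_cases j <;>
    simp [refMatrix, observableEffect, rotObservable, pauliZ, pauliX, h, -Complex.ofReal_cos,
      -Complex.ofReal_sin] <;> ring

theorem refMatrix_bob : refMatrix (Real.pi / 4) 0 1 = !![1 / 2, -1 / 2; -1 / 2, 1 / 2] := by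
  have h : 2 * (Real.pi / 4) = Real.pi / 2 := by ring
  ext i j
  fin_cases i <;> fin_cases j <;>
    simp [refMatrix, observableEffect, rotObservable, pauliZ, pauliX, h, -Complex.ofReal_cos,
      -Complex.ofReal_sin] <;> ring

/-- The amplitudes of the reference state in the basis `|k⟩|l⟩`. -/
def refAmplitude : Matrix (Fin 2) (Fin 2) ℂ :=
  !![0, (√2 / 2 * (√3 / 2) : ℝ); (√2 / 2 : ℝ), -(√2 / 2 * (1 / 2) : ℝ)]

theorem refState_eq : refState (Real.pi / 6) (Real.pi / 4)
    = ∑ k, ∑ l, refAmplitude k l • ket k ⊗ₜ[ℂ] ket l := by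
  simp only [refState, refAmplitude, Fin.sum_univ_two, Real.sin_pi_div_four, Real.cos_pi_div_four,
    Real.sin_pi_div_six, Real.cos_pi_div_six, TensorProduct.sub_tmul, ← TensorProduct.smul_tmul']
  simp
  module

theorem HTensor.of_refState : HTensor.of (refState (Real.pi / 6) (Real.pi / 4))
    = ∑ k, ∑ l, refAmplitude k l • HTensor.tmul (ket k) (ket l) := by
  rw [refState_eq]
  simp only [map_sum, map_smul]
  rfl

theorem refState_realizes :
    Realizes correlationQ3 (HTensor.of (refState (Real.pi / 6) (Real.pi / 4)))
      (refMeasurement (Real.pi / 6)) (refMeasurement (Real.pi / 4)) := by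
  have h2 : ((√2 : ℝ) : ℂ) ^ 2 = 2 := by norm_cast; simp
  have h3 : ((√3 : ℝ) : ℂ) ^ 2 = 3 := by norm_cast; simp
  rw [HTensor.of_refState]
  constructor
  · rw [@norm_eq_sqrt_re_inner ℂ, Real.sqrt_eq_one]
    refine (congrArg Complex.re ?_).trans Complex.one_re
    simp only [Fin.sum_univ_two, inner_add_left, inner_add_right, inner_smul_left, inner_smul_right,
      HTensor.inner_tmul, inner_ket]
    simp [refAmplitude, map_ofNat]
    ring_nf
    norm_num [h2, h3]
  · intro a b x y
    simp only [map_sum, map_smul, HTensor.map_tmul, refMeasurement_ket]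
    simp only [Fin.sum_univ_two, inner_add_left, inner_add_right, inner_smul_left, inner_smul_right,
      HTensor.inner_tmul, inner_ket, HTensor.add_tmul, HTensor.tmul_add,
      HTensor.smul_tmul, HTensor.tmul_smul]
    simp only [refAmplitude]
    fin_cases x <;> fin_cases y <;> fin_cases a <;> fin_cases b <;>
      simp [refMatrix_zero_zero, refMatrix_one, refMatrix_alice, refMatrix_bob, correlationQ3,
        map_ofNat] <;> ring_nf <;> norm_num [h2, h3]

end Reference

/-! ### Projective strategies -/

section Projective

/-- A measurement is projective if its effects are idempotent. -/
def Povm.IsProjective {H : Type} [NormedAddCommGroup H] [InnerProductSpace ℂ H] (M : Povm H) :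
    Prop :=
  ∀ a, M.effect a ∘L M.effect a = M.effect a

variable {HA HB : Type} [NormedAddCommGroup HA] [InnerProductSpace ℂ HA] [CompleteSpace HA]
  [NormedAddCommGroup HB] [InnerProductSpace ℂ HB] [CompleteSpace HB]

theorem HTensor.inner_map_of_adjoint {f : HA →L[ℂ] HA} {g : HB →L[ℂ] HB} (hf : f.adjoint = f)
    (hg : g.adjoint = g) (u v : HTensor HA HB) :
    inner ℂ (HTensor.map f g u) v = inner ℂ u (HTensor.map f g v) := by
  rw [← ContinuousLinearMap.adjoint_inner_right, HTensor.adjoint_map, hf, hg]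

theorem Povm.adjoint_effect {H : Type} [NormedAddCommGroup H] [InnerProductSpace ℂ H]
    [CompleteSpace H] (M : Povm H) (a : Fin 2) : (M.effect a).adjoint = M.effect a :=
  (M.isPositive a).isSelfAdjoint.adjoint_eq

theorem isCHSHAlgebra_of_isProjective {M : Fin 2 → Povm HA} {N : Fin 2 → Povm HB}
    (hM : ∀ x, (M x).IsProjective) (hN : ∀ y, (N y).IsProjective) :
    IsCHSHAlgebra (HTensor.map ((M 0).effect 1) (1 : HB →L[ℂ] HB))
      (HTensor.map ((M 1).effect 0) (1 : HB →L[ℂ] HB))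
      (HTensor.map (1 : HA →L[ℂ] HA) ((N 0).effect 0))
      (HTensor.map (1 : HA →L[ℂ] HA) (1 - (2 : ℂ) • (N 1).effect 0)) := by
  have hB : (1 - (2 : ℂ) • (N 1).effect 0).adjoint = 1 - (2 : ℂ) • (N 1).effect 0 := by
    rw [map_sub, adjoint_one_eq, map_smulₛₗ, (N 1).adjoint_effect, map_ofNat]
  have hB2 : (1 - (2 : ℂ) • (N 1).effect 0) ∘L (1 - (2 : ℂ) • (N 1).effect 0) = 1 := by
    ext v
    have := DFunLike.congr_fun (hN 1 0) v
    simp only [ContinuousLinearMap.comp_apply, sub_apply, smul_apply, one_apply_eq_self, map_sub,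
      map_smul] at this ⊢
    rw [this]
    module
  have hc : ∀ (f : HA →L[ℂ] HA) (g : HB →L[ℂ] HB) v,
      HTensor.map f (1 : HB →L[ℂ] HB) (HTensor.map (1 : HA →L[ℂ] HA) g v)
        = HTensor.map (1 : HA →L[ℂ] HA) g (HTensor.map f (1 : HB →L[ℂ] HB) v) := by
    intro f g v
    rw [HTensor.map_map, HTensor.map_map]; rfl
  constructor
  · exact HTensor.inner_map_of_adjoint ((M 0).adjoint_effect 1) adjoint_one_eq
  · exact HTensor.inner_map_of_adjoint ((M 1).adjoint_effect 0) adjoint_one_eq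
  · exact HTensor.inner_map_of_adjoint adjoint_one_eq ((N 0).adjoint_effect 0)
  · exact HTensor.inner_map_of_adjoint adjoint_one_eq hB
  · intro v; rw [HTensor.map_map, hM]; rfl
  · intro v; rw [HTensor.map_map, hM]; rfl
  · intro v; rw [HTensor.map_map, hN]; rfl
  · intro v
    rw [HTensor.map_map, hB2]
    exact DFunLike.congr_fun HTensor.map_one v
  all_goals intro v; exact hc _ _ v

/-- For projective measurements, a vanishing probability annihilates the state. -/
theorem Realizes.map_eq_zero {P : Correlation} {ψ : HTensor HA HB} {M : Fin 2 → Povm HA}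
    {N : Fin 2 → Povm HB} (h : Realizes P ψ M N) (hM : ∀ x, (M x).IsProjective)
    (hN : ∀ y, (N y).IsProjective) {a b x y : Fin 2} (h0 : P a b x y = 0) :
    HTensor.map ((M x).effect a) ((N y).effect b) ψ = 0 := by
  refine inner_self_eq_zero (𝕜 := ℂ).mp ?_
  rw [HTensor.inner_map_of_adjoint ((M x).adjoint_effect a) ((N y).adjoint_effect b),
    HTensor.map_map, hM, hN, h.2, h0, Complex.ofReal_zero]

variable {P : Correlation} {ψ : HTensor HA HB} {M : Fin 2 → Povm HA} {N : Fin 2 → Povm HB}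

/-- The components `x = G ψ` and `y = (1 - G) ψ` of the state, `G` being Bob's first effect, under
the two zero constraints. -/
theorem Realizes.components (h : Realizes P ψ M N) (hM : ∀ x, (M x).IsProjective)
    (hN : ∀ y, (N y).IsProjective) (h0 : P 0 0 0 0 = 0) (h1 : P 1 1 1 0 = 0) :
    ∃ x y : HTensor HA HB, ψ = x + y ∧ HTensor.map (1 : HA →L[ℂ] HA) ((N 0).effect 0) x = x ∧
      HTensor.map (1 : HA →L[ℂ] HA) ((N 0).effect 0) y = 0 ∧
      HTensor.map ((M 0).effect 1) (1 : HB →L[ℂ] HB) x = x ∧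
      HTensor.map ((M 1).effect 0) (1 : HB →L[ℂ] HB) y = y := by
  have hA := isCHSHAlgebra_of_isProjective hM hN
  set G := HTensor.map (1 : HA →L[ℂ] HA) ((N 0).effect 0) with hG
  refine ⟨G ψ, ψ - G ψ, by abel, hA.G_G _, by rw [map_sub, hA.G_G, sub_self], ?_, ?_⟩
  · have := h.map_eq_zero hM hN h0
    rw [(M 0).effect_one_eq, HTensor.map_sub_left, HTensor.map_one, sub_apply, one_apply_eq_self,
      hG, HTensor.map_map, sub_eq_self]
    exact this
  · have := h.map_eq_zero hM hN h1
    have e : HTensor.map ((M 1).effect 1) ((N 0).effect 1) ψ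
        = HTensor.map ((M 1).effect 1) (1 : HB →L[ℂ] HB)
          (HTensor.map (1 : HA →L[ℂ] HA) ((N 0).effect 1) ψ) := by
      rw [HTensor.map_map]; rfl
    rw [e, (M 1).effect_one_eq, (N 0).effect_one_eq, HTensor.map_sub_left, HTensor.map_sub_right,
      HTensor.map_one, sub_apply, sub_eq_zero] at this
    exact this.symm

omit [CompleteSpace HA] [CompleteSpace HB] in
theorem Realizes.chshValue_projective (h : Realizes P ψ M N) (h0 : P 0 0 0 0 = 0)
    (h1 : P 1 1 1 0 = 0) :
    chshValue P = 2 + 2 * (inner ℂ ψ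
        (ψ - HTensor.map ((M 0).effect 1) (1 : HB →L[ℂ] HB) ψ
          - HTensor.map ((M 1).effect 0) (1 : HB →L[ℂ] HB) ψ
          + HTensor.map (1 : HA →L[ℂ] HA) (1 - (2 : ℂ) • (N 1).effect 0)
            (ψ - HTensor.map ((M 0).effect 1) (1 : HB →L[ℂ] HB) ψ
          - HTensor.map ((M 1).effect 0) (1 : HB →L[ℂ] HB) ψ))).re := by
  rw [h.chshValue_of_zeros h0 h1]
  have e1 := h.2 0 1 0 1
  have e2 := h.2 0 1 1 1
  have e : ∀ v, (2 : ℂ) • HTensor.map (1 : HA →L[ℂ] HA) ((N 1).effect 1) v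
      = v + HTensor.map (1 : HA →L[ℂ] HA) (1 - (2 : ℂ) • (N 1).effect 0) v := by
    intro v
    rw [(N 1).effect_one_eq, HTensor.map_sub_right, HTensor.map_sub_right, HTensor.map_smul_right,
      HTensor.map_one]
    simp only [sub_apply, one_apply_eq_self, smul_apply]
    module
  rw [← e]
  have e3 : HTensor.map (1 : HA →L[ℂ] HA) ((N 1).effect 1)
      (ψ - HTensor.map ((M 0).effect 1) (1 : HB →L[ℂ] HB) ψ
          - HTensor.map ((M 1).effect 0) (1 : HB →L[ℂ] HB) ψ)
      = HTensor.map ((M 0).effect 0) ((N 1).effect 1) ψ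
        - HTensor.map ((M 1).effect 0) ((N 1).effect 1) ψ := by
    rw [(M 0).effect_one_eq, HTensor.map_sub_left, HTensor.map_one, sub_apply, one_apply_eq_self,
      sub_sub_cancel, map_sub, HTensor.map_map, HTensor.map_map]
    rfl
  rw [e3, inner_smul_right, inner_sub_right, e1, e2, ← Complex.ofReal_sub]
  simp
  ring

/-- The deficit `5/2 - chshValue P` is half of a sum of squares. -/
theorem Realizes.chshValue_eq_sub_sum_of_squares (h : Realizes P ψ M N)
    (hM : ∀ x, (M x).IsProjective) (hN : ∀ y, (N y).IsProjective)
    (h0 : P 0 0 0 0 = 0) (h1 : P 1 1 1 0 = 0) {x y : HTensor HA HB} (hψ : ψ = x + y)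
    {A F G B : HTensor HA HB →L[ℂ] HTensor HA HB}
    (hA : A = HTensor.map ((M 0).effect 1) (1 : HB →L[ℂ] HB))
    (hF : F = HTensor.map ((M 1).effect 0) (1 : HB →L[ℂ] HB))
    (hG : G = HTensor.map (1 : HA →L[ℂ] HA) ((N 0).effect 0))
    (hB : B = HTensor.map (1 : HA →L[ℂ] HA) (1 - (2 : ℂ) • (N 1).effect 0))
    (hGx : G x = x) (hGy : G y = 0) (hAx : A x = x) (hFy : F y = y) :
    chshValue P = 5 / 2 - (‖x + (2 : ℂ) • G (B (A (y + F x)))‖ ^ 2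
      + ‖y + (2 : ℂ) • (1 - G) (B (F (x + A y)))‖ ^ 2
      + 4 * ‖G (B (F x - A (F x)))‖ ^ 2 + 4 * ‖(1 - G) (B (A y - F (A y)))‖ ^ 2) / 2 := by
  have hC : IsCHSHAlgebra A F G B := by
    subst hA hF hG hB
    exact isCHSHAlgebra_of_isProjective hM hN
  rw [h.chshValue_projective h0 h1, hC.sum_of_squares hGx hGy hAx hFy, ← hA, ← hF, ← hB, ← hψ, h.1]
  ring

theorem Realizes.chshValue_le_of_isProjective (h : Realizes P ψ M N)
    (hM : ∀ x, (M x).IsProjective) (hN : ∀ y, (N y).IsProjective)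
    (h0 : P 0 0 0 0 = 0) (h1 : P 1 1 1 0 = 0) : chshValue P ≤ 5 / 2 := by
  obtain ⟨x, y, hψ, hGx, hGy, hAx, hFy⟩ := h.components hM hN h0 h1
  rw [h.chshValue_eq_sub_sum_of_squares hM hN h0 h1 hψ rfl rfl rfl rfl hGx hGy hAx hFy]
  refine sub_le_self _ ?_
  positivity

/-- At the maximum all squares vanish, and `A`, `F`, `G`, `B` act on the span of `x`, `y`, `B x`,
`B y` by explicit matrices, from which the hypotheses of `locallyReducesTo_of_swap` are read off.
The extracted junk state is `√2 x`. -/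
theorem Realizes.locallyReducesTo_of_isProjective (h : Realizes P ψ M N)
    (hM : ∀ x, (M x).IsProjective) (hN : ∀ y, (N y).IsProjective)
    (h0 : P 0 0 0 0 = 0) (h1 : P 1 1 1 0 = 0) (hS : chshValue P = 5 / 2) :
    LocallyReducesTo ψ M N (refState (Real.pi / 6) (Real.pi / 4))
      (refMeasurement (Real.pi / 6)) (refMeasurement (Real.pi / 4)) := by
  have hC := isCHSHAlgebra_of_isProjective hM hN
  obtain ⟨x, y, hψ, hGx, hGy, hAx, hFy⟩ := h.components hM hN h0 h1
  have hsos := h.chshValue_eq_sub_sum_of_squares hM hN h0 h1 hψ rfl rfl rfl rfl hGx hGy hAx hFy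
  rw [hS] at hsos
  set p := (M 0).effect 1 with hp
  set f := (M 1).effect 0 with hf
  set g := (N 0).effect 0 with hg
  set b := 1 - (2 : ℂ) • (N 1).effect 0 with hb
  set A := HTensor.map p (1 : HB →L[ℂ] HB) with hA
  set F := HTensor.map f (1 : HB →L[ℂ] HB) with hF
  set G := HTensor.map (1 : HA →L[ℂ] HA) g with hG
  set B := HTensor.map (1 : HA →L[ℂ] HA) b with hB
  obtain ⟨hGBx, hGBy, hBx, hBy, hxy⟩ := hC.relations hGx hGy hAx hFy
    (by rw [← norm_eq_zero, ← sq_eq_zero_iff]; apply le_antisymm _ (sq_nonneg _)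
        linarith [sq_nonneg ‖y + (2 : ℂ) • (1 - G) (B (F (x + A y)))‖,
          sq_nonneg ‖G (B (F x - A (F x)))‖, sq_nonneg ‖(1 - G) (B (A y - F (A y)))‖])
    (by rw [← norm_eq_zero, ← sq_eq_zero_iff]; apply le_antisymm _ (sq_nonneg _)
        linarith [sq_nonneg ‖x + (2 : ℂ) • G (B (A (y + F x)))‖,
          sq_nonneg ‖G (B (F x - A (F x)))‖, sq_nonneg ‖(1 - G) (B (A y - F (A y)))‖])
    (by rw [← norm_eq_zero, ← sq_eq_zero_iff]; apply le_antisymm _ (sq_nonneg _)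
        linarith [sq_nonneg ‖y + (2 : ℂ) • (1 - G) (B (F (x + A y)))‖,
          sq_nonneg ‖x + (2 : ℂ) • G (B (A (y + F x)))‖,
          sq_nonneg ‖(1 - G) (B (A y - F (A y)))‖])
    (by rw [← norm_eq_zero, ← sq_eq_zero_iff]; apply le_antisymm _ (sq_nonneg _)
        linarith [sq_nonneg ‖y + (2 : ℂ) • (1 - G) (B (F (x + A y)))‖,
          sq_nonneg ‖x + (2 : ℂ) • G (B (A (y + F x)))‖,
          sq_nonneg ‖G (B (F x - A (F x)))‖])
  have hAy : A y = (-1 / 2 : ℂ) • B x := by rw [hBx]; module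
  have hFx : F x = (-1 / 2 : ℂ) • B y := by rw [hBy]; module
  have hABx : A (B x) = B x := by rw [hC.P_B, hAx]
  have hABy : A (B y) = (-1 / 2 : ℂ) • x := by rw [hC.P_B, hAy, map_smul, hC.B_B]
  have hFBx : F (B x) = (-1 / 2 : ℂ) • y := by rw [hC.F_B, hFx, map_smul, hC.B_B]
  have hFBy : F (B y) = B y := by rw [hC.F_B, hFy]
  have hBBx := hC.B_B x
  have hBBy := hC.B_B y
  have hnorm : ‖x‖ ^ 2 = 1 / 2 := by
    have hort : inner ℂ x y = 0 := by rw [← hGx, hC.inner_G, hGy, inner_zero_right]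
    have := norm_add_sq_eq_norm_sq_add_norm_sq_of_inner_eq_zero x y hort
    rw [← hψ, h.1, ← hxy] at this
    linarith
  clear hsos hBx hBy
  have h3 : ((√3 : ℝ) : ℂ) ^ 2 = 3 := by norm_cast; simp
  have h2 : ((√2 : ℝ) : ℂ) ^ 2 = 2 := by norm_cast; simp
  have hl : ∀ (a c : HA →L[ℂ] HA) v, HTensor.map (a ∘L c) (1 : HB →L[ℂ] HB) v
      = HTensor.map a (1 : HB →L[ℂ] HB) (HTensor.map c (1 : HB →L[ℂ] HB) v) := by
    intro a c v; rw [HTensor.map_map]; rfl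
  have hr : ∀ (a c : HB →L[ℂ] HB) v, HTensor.map (1 : HA →L[ℂ] HA) (a ∘L c) v
      = HTensor.map (1 : HA →L[ℂ] HA) a (HTensor.map (1 : HA →L[ℂ] HA) c v) := by
    intro a c v; rw [HTensor.map_map]; rfl
  have hlr : ∀ (a : HA →L[ℂ] HA) (c : HB →L[ℂ] HB) v, HTensor.map a c v
      = HTensor.map a (1 : HB →L[ℂ] HB) (HTensor.map (1 : HA →L[ℂ] HA) c v) := by
    intro a c v; rw [HTensor.map_map]; rfl
  have hpa : p.adjoint = p := (M 0).adjoint_effect 1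
  have hfa : f.adjoint = f := (M 1).adjoint_effect 0
  have hga : g.adjoint = g := (N 0).adjoint_effect 0
  have hba : b.adjoint = b := by
    rw [hb, map_sub, adjoint_one_eq, map_smulₛₗ, (N 1).adjoint_effect, map_ofNat]
  have hA0 : ∀ v, HTensor.map ((M 0).effect 0) (1 : HB →L[ℂ] HB) v = v - A v := by
    intro v
    rw [hA, hp, (M 0).effect_one_eq, HTensor.map_sub_left, HTensor.map_one]; simp
  have hF1 : ∀ v, HTensor.map ((M 1).effect 1) (1 : HB →L[ℂ] HB) v = v - F v := by
    intro v
    rw [(M 1).effect_one_eq, HTensor.map_sub_left, HTensor.map_one]; rfl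
  have hG1 : ∀ v, HTensor.map (1 : HA →L[ℂ] HA) ((N 0).effect 1) v = v - G v := by
    intro v
    rw [(N 0).effect_one_eq, HTensor.map_sub_right, HTensor.map_one]; rfl
  have hB0 : ∀ v, HTensor.map (1 : HA →L[ℂ] HA) ((N 1).effect 0) v
      = (1 / 2 : ℂ) • (v - B v) := by
    intro v
    rw [hB, hb, HTensor.map_sub_right, HTensor.map_one, HTensor.map_smul_right]
    simp only [sub_apply, one_apply_eq_self, smul_apply]
    module
  have hB1 : ∀ v, HTensor.map (1 : HA →L[ℂ] HA) ((N 1).effect 1) v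
      = (1 / 2 : ℂ) • (v + B v) := by
    intro v
    rw [(N 1).effect_one_eq, HTensor.map_sub_right, HTensor.map_one, sub_apply, hB0,
      one_apply_eq_self]
    module
  -- On the span of `x`, `y`, `B x`, `B y`, the operator `w` is the partial isometry that sends
  -- Alice's `|0⟩` to her `|1⟩`; `4 / 3 * √3` is the inverse of `|⟨1|F|0⟩| = √3 / 4`.
  obtain ⟨w, hw, hwa⟩ : ∃ w : HA →L[ℂ] HA,
      (∀ v, HTensor.map w (1 : HB →L[ℂ] HB) v
        = (-(4 / 3 * (√3 : ℝ)) : ℂ) • (A (F (v - A v)))) ∧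
      (∀ v, HTensor.map w.adjoint (1 : HB →L[ℂ] HB) v
        = (-(4 / 3 * (√3 : ℝ)) : ℂ) • (F (A v) - A (F (A v)))) := by
    refine ⟨(-(4 / 3 * (√3 : ℝ)) : ℂ) • (p ∘L f ∘L (1 - p)), fun v => ?_, fun v => ?_⟩
    · rw [HTensor.map_smul_left, smul_apply, hl, hl, HTensor.map_sub_left, HTensor.map_one]; rfl
    · have : ((-(4 / 3 * (√3 : ℝ)) : ℂ) • (p ∘L f ∘L (1 - p))).adjoint
          = (-(4 / 3 * (√3 : ℝ)) : ℂ) • ((1 - p) ∘L f ∘L p) := by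
        rw [map_smulₛₗ, ContinuousLinearMap.adjoint_comp, ContinuousLinearMap.adjoint_comp,
          map_sub, adjoint_one_eq, hpa, hfa]
        simp [map_ofNat]
        rfl
      rw [this, HTensor.map_smul_left, smul_apply, hl, hl, HTensor.map_sub_left, HTensor.map_one]
      rfl
  -- Likewise `u` sends Bob's `|1⟩` to his `|0⟩`, as `B` acts as `σ_x`.
  obtain ⟨u, hu, hua⟩ : ∃ u : HB →L[ℂ] HB,
      (∀ v, HTensor.map (1 : HA →L[ℂ] HA) u v = G (B (v - G v))) ∧
      (∀ v, HTensor.map (1 : HA →L[ℂ] HA) u.adjoint v = B (G v) - G (B (G v))) := by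
    refine ⟨g ∘L b ∘L (1 - g), fun v => ?_, fun v => ?_⟩
    · rw [hr, hr, HTensor.map_sub_right 1 1 g, HTensor.map_one]; rfl
    · rw [ContinuousLinearMap.adjoint_comp, ContinuousLinearMap.adjoint_comp,
        map_sub, adjoint_one_eq, hga, hba, hr, hr, HTensor.map_sub_right 1 1 g, HTensor.map_one]
      rfl
  refine locallyReducesTo_of_swap ![w, p] ![g, u] (((√2 : ℝ) : ℂ) • x) ?_
    (refMatrix (Real.pi / 6)) (refMatrix (Real.pi / 4)) refAmplitude
    (refMeasurement_ket _) (refMeasurement_ket _) refState_eq ?_ ?_ ?_ ?_ ?_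
  · rw [norm_smul, Complex.norm_real, Real.norm_of_nonneg (Real.sqrt_nonneg 2),
      ← sq_eq_sq₀ (by positivity) zero_le_one, mul_pow, hnorm]
    norm_num
  · have key : ∀ v, HTensor.map (∑ i, (![w, p] i).adjoint ∘L ![w, p] i) (1 : HB →L[ℂ] HB) v
        = (16 / 3 : ℂ) • (F (A (F (v - A v))) - A (F (A (F (v - A v))))) + A v := by
      intro v
      have hc : (-(4 / 3 * (√3 : ℝ)) : ℂ) * -(4 / 3 * (√3 : ℝ)) = 16 / 3 := by
        linear_combination 16 / 9 * h3
      simp only [Fin.sum_univ_two, Matrix.cons_val_zero, Matrix.cons_val_one,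
        HTensor.map_add_left, add_apply, hl, hw, hwa, hpa, map_smul, ← smul_sub, smul_smul, hc,
        hC.P_P, ← hA]
    intro a s
    rw [key]
    fin_cases s <;> fin_cases a <;>
      simp only [Fin.zero_eta, Fin.mk_one, ← hp, ← hf, ← hA, ← hF, hA0, hF1, hψ, map_add, map_sub,
        map_smul, hAx, hAy, hABx, hABy, hFx, hFy, hFBx, hFBy] <;>
      module
  · have key : ∀ v, HTensor.map (1 : HA →L[ℂ] HA) (∑ j, (![g, u] j).adjoint ∘L ![g, u] j) v
        = G v + (B (G (B (v - G v))) - G (B (G (B (v - G v))))) := by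
      intro v
      simp only [Fin.sum_univ_two, Matrix.cons_val_zero, Matrix.cons_val_one,
        HTensor.map_add_right, add_apply, hr, hu, hua, hga, hC.G_G, ← hG]
    intro a s
    rw [key]
    fin_cases s <;> fin_cases a <;>
      simp only [Fin.zero_eta, Fin.mk_one, ← hg, ← hG, hG1, hB0, hB1, hψ, map_add, map_sub,
        map_smul, map_zero, hGx, hGy, hGBx, hGBy, hBBx, hBBy] <;>
      module
  · intro i a s
    fin_cases s <;> fin_cases a <;> fin_cases i <;>
      simp [refMatrix_zero_zero, refMatrix_one, refMatrix_alice, ← hp, ← hf, ← hA, ← hF, hA0, hF1,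
        hw, hψ, map_add, map_sub, map_smul, hAx, hAy, hABx, hABy, hFx, hFy, hFBx, hFBy] <;>
      (match_scalars <;> ring_nf <;> norm_num [h3])
  · intro i a s
    fin_cases s <;> fin_cases a <;> fin_cases i <;>
      simp [refMatrix_zero_zero, refMatrix_one, refMatrix_bob, ← hg, ← hG, hG1, hB0, hB1,
        hu, hψ, map_add, map_sub, map_smul, hGx, hGy, hGBx, hGBy, hBBx, hBBy] <;>
      module
  · intro k l
    rw [hlr]
    fin_cases k <;> fin_cases l <;>
      simp [refAmplitude, ← hA, ← hG, hw, hu, hψ, map_add, map_sub, map_smul, hAx, hABy,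
        hFx, hFBy, hGx, hGy, hGBy] <;>
      match_scalars <;>
      first
        | linear_combination (-(√3 : ℝ) / 4 : ℂ) * h2
        | linear_combination (-1 / 2 : ℂ) * h2
        | linear_combination (-1 / 4 : ℂ) * h2
        | linear_combination (1 / 4 : ℂ) * h2

end Projective

/-! ### Dilation to projective strategies -/

section Dilation

variable {H : Type} [NormedAddCommGroup H] [InnerProductSpace ℂ H] [CompleteSpace H]

theorem CStarAlgebra.exists_sqrt_mul_one_sub {A : Type*} [CStarAlgebra A] [PartialOrder A]
    [StarOrderedRing A] {e : A} (h0 : 0 ≤ e) (h1 : 0 ≤ 1 - e) :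
    ∃ r : A, 0 ≤ r ∧ r * r = e * (1 - e) ∧ Commute r e := by
  have hcomm : Commute e (1 - e) := (Commute.one_right e).sub_right (Commute.refl e)
  have hee : 0 ≤ e * (1 - e) := Commute.mul_nonneg h0 h1 hcomm
  exact ⟨CFC.sqrt (e * (1 - e)), CFC.sqrt_nonneg _, CFC.sqrt_mul_sqrt_self _ hee,
    Commute.cfcₙ_nnreal ((Commute.refl e).mul_left hcomm.symm) _⟩

theorem exists_sqrt_mul_one_sub {E : H →L[ℂ] H} (hE0 : E.IsPositive) (hE1 : (1 - E).IsPositive) :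
    ∃ R : H →L[ℂ] H, R.adjoint = R ∧ (∀ v, R (R v) = E v - E (E v)) ∧
      ∀ v, R (E v) = E (R v) := by
  rw [← ContinuousLinearMap.nonneg_iff_isPositive] at hE0 hE1
  obtain ⟨R, hR, hRR, hRE⟩ := CStarAlgebra.exists_sqrt_mul_one_sub hE0 hE1
  refine ⟨R, ((ContinuousLinearMap.nonneg_iff_isPositive _).mp hR).isSelfAdjoint.adjoint_eq,
    fun v => ?_, fun v => DFunLike.congr_fun hRE v⟩
  have := DFunLike.congr_fun hRR v
  simpa using this

/-- Halmos dilation: an effect `E` is the corner of the projection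
`[[E, √(E(1-E))], [√(E(1-E)), 1 - E]]`. -/
theorem exists_projection_dilation {E : H →L[ℂ] H} (hE0 : E.IsPositive)
    (hE1 : (1 - E).IsPositive) :
    ∃ T : HTensor H Qubit →L[ℂ] HTensor H Qubit, T ∘L T = T ∧ T.adjoint = T ∧
      ∀ v, (slot 0).adjoint (T (slot 0 v)) = E v := by
  obtain ⟨R, hRa, hRR, hRE⟩ := exists_sqrt_mul_one_sub hE0 hE1
  have hEa : E.adjoint = E := hE0.isSelfAdjoint.adjoint_eq
  refine ⟨slot 0 ∘L (E ∘L (slot 0).adjoint + R ∘L (slot 1).adjoint)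
      + slot 1 ∘L (R ∘L (slot 0).adjoint + (1 - E) ∘L (slot 1).adjoint), ?_, ?_, ?_⟩
  · ext v
    simp only [ContinuousLinearMap.comp_apply, add_apply, sub_apply, one_apply_eq_self, map_add,
      map_sub, adjoint_slot_slot, if_true, zero_ne_one, one_ne_zero, if_false, hRR, hRE, map_zero]
    abel
  · simp only [map_add, map_sub, ContinuousLinearMap.adjoint_comp,
      ContinuousLinearMap.adjoint_adjoint, hRa, hEa, adjoint_one_eq]
    ext v
    simp only [add_apply, ContinuousLinearMap.comp_apply, map_add]
    abel
  · intro v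
    simp [adjoint_slot_slot]

omit [CompleteSpace H] in
theorem comp_one_sub_self {T : H →L[ℂ] H} (h : T ∘L T = T) : (1 - T) ∘L (1 - T) = 1 - T := by
  ext v
  have := DFunLike.congr_fun h v
  simp only [ContinuousLinearMap.comp_apply, sub_apply, one_apply_eq_self, map_sub] at this ⊢
  rw [this]
  abel

theorem isPositive_of_projection {T : H →L[ℂ] H} (h1 : T ∘L T = T) (h2 : T.adjoint = T) :
    T.IsPositive := by
  have := ContinuousLinearMap.isPositive_adjoint_comp_self T
  rwa [h2, h1] at this

/-- Every measurement is the compression of a projective one along `slot 0`. The isometry does not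
depend on the measurement, so both settings of a party are dilated at once. -/
theorem Povm.exists_dilation (M : Povm H) : ∃ Q : Povm (HTensor H Qubit), Q.IsProjective ∧
    ∀ a v, (slot 0).adjoint (Q.effect a (slot 0 v)) = M.effect a v := by
  obtain ⟨T, hTT, hTa, hT⟩ := exists_projection_dilation (M.isPositive 0)
    (M.effect_one_eq ▸ M.isPositive 1)
  refine ⟨⟨![T, 1 - T], ?_, by simp⟩, ?_, ?_⟩
  · intro a
    fin_cases a
    · exact isPositive_of_projection hTT hTa
    · exact isPositive_of_projection (T := 1 - T) (comp_one_sub_self hTT)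
        (by rw [map_sub, adjoint_one_eq, hTa])
  · intro a
    fin_cases a
    · exact hTT
    · exact comp_one_sub_self hTT
  · intro a v
    fin_cases a
    · exact hT v
    · change (slot 0).adjoint ((1 - T) (slot 0 v)) = M.effect 1 v
      rw [M.effect_one_eq, sub_apply, one_apply_eq_self, map_sub, adjoint_slot_slot, hT]
      rfl

theorem adjoint_slot_comp_slot : (slot (H := H) 0).adjoint ∘L slot 0 = 1 := by
  ext v; simp [adjoint_slot_slot]

variable {HA HB : Type} [NormedAddCommGroup HA] [InnerProductSpace ℂ HA] [CompleteSpace HA]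
  [NormedAddCommGroup HB] [InnerProductSpace ℂ HB] [CompleteSpace HB]
  {P : Correlation} {ψ : HTensor HA HB} {M : Fin 2 → Povm HA} {N : Fin 2 → Povm HB}

theorem Realizes.exists_dilation (h : Realizes P ψ M N) :
    ∃ (Q : Fin 2 → Povm (HTensor HA Qubit)) (R : Fin 2 → Povm (HTensor HB Qubit)),
      (∀ x, (Q x).IsProjective) ∧ (∀ y, (R y).IsProjective) ∧
      (∀ a x v, (slot 0).adjoint ((Q x).effect a (slot 0 v)) = (M x).effect a v) ∧
      (∀ b y v, (slot 0).adjoint ((R y).effect b (slot 0 v)) = (N y).effect b v) ∧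
      Realizes P (HTensor.map (slot 0) (slot 0) ψ) Q R := by
  choose Q hQ hQM using fun x => (M x).exists_dilation
  choose R hR hRN using fun y => (N y).exists_dilation
  refine ⟨Q, R, hQ, hR, fun a x => hQM x a, fun b y => hRN y b, ?_, fun a b x y => ?_⟩
  · have : inner ℂ (HTensor.map (slot 0) (slot 0) ψ) (HTensor.map (slot 0) (slot 0) ψ)
        = inner ℂ ψ ψ := by
      rw [← ContinuousLinearMap.adjoint_inner_right, HTensor.adjoint_map, HTensor.map_map,
        adjoint_slot_comp_slot, adjoint_slot_comp_slot, HTensor.map_one, one_apply_eq_self]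
    rw [@norm_eq_sqrt_re_inner ℂ, this, ← @norm_eq_sqrt_re_inner ℂ, h.1]
  · rw [← ContinuousLinearMap.adjoint_inner_right, HTensor.adjoint_map, HTensor.map_map,
      HTensor.map_map, ← h.2]
    congr 3
    · ext v; exact hQM x a v
    · ext v; exact hRN y b v

theorem Realizes.chshValue_le (h : Realizes P ψ M N) (h0 : P 0 0 0 0 = 0) (h1 : P 1 1 1 0 = 0) :
    chshValue P ≤ 5 / 2 := by
  obtain ⟨Q, R, hQ, hR, -, -, h'⟩ := h.exists_dilation
  exact h'.chshValue_le_of_isProjective hQ hR h0 h1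

theorem HTensor.inner_map_map {HA' HB' : Type} [NormedAddCommGroup HA'] [InnerProductSpace ℂ HA']
    [CompleteSpace HA'] [NormedAddCommGroup HB'] [InnerProductSpace ℂ HB'] [CompleteSpace HB']
    {f f' : HA →L[ℂ] HA'} {g g' : HB →L[ℂ] HB'} {c d : ℂ} (hf : f.adjoint ∘L f' = c • 1)
    (hg : g.adjoint ∘L g' = d • 1) (v w : HTensor HA HB) :
    inner ℂ (HTensor.map f g v) (HTensor.map f' g' w) = c * d * inner ℂ v w := by
  rw [← ContinuousLinearMap.adjoint_inner_right, HTensor.adjoint_map, HTensor.map_map, hf, hg,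
    HTensor.map_smul_left, HTensor.map_smul_right, HTensor.map_one, smul_smul, smul_apply,
    one_apply_eq_self, inner_smul_right]

theorem adjoint_tmulRight_comp {K : Type} [NormedAddCommGroup K] [InnerProductSpace ℂ K] (x y : K) :
    (HTensor.tmulRight (H := H) x).adjoint ∘L HTensor.tmulRight y = (inner ℂ x y : ℂ) • 1 := by
  ext v
  refine ext_inner_left ℂ fun z => ?_
  rw [ContinuousLinearMap.comp_apply, ContinuousLinearMap.adjoint_inner_right,
    HTensor.tmulRight_apply, HTensor.tmulRight_apply, HTensor.inner_tmul, smul_apply,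
    one_apply_eq_self, inner_smul_right, mul_comm]

theorem inner_attach {KA KB : Type} [NormedAddCommGroup KA] [InnerProductSpace ℂ KA]
    [NormedAddCommGroup KB] [InnerProductSpace ℂ KB] (s t : KA ⊗[ℂ] KB) (v w : HTensor HA HB) :
    inner ℂ (HTensor.attach s v) (HTensor.attach t w) = inner ℂ s t * inner ℂ v w := by
  induction s using TensorProduct.induction_on with
  | zero => simp
  | add s s' hs hs' => simp only [map_add, add_apply, inner_add_left, hs, hs', add_mul]
  | tmul x y =>
    induction t using TensorProduct.induction_on with
    | zero => simp
    | add t t' ht ht' => simp only [map_add, add_apply, inner_add_right, ht, ht', add_mul]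
    | tmul x' y' =>
      rw [HTensor.attach, TensorProduct.lift.tmul, TensorProduct.lift.tmul,
        TensorProduct.inner_tmul]
      exact HTensor.inner_map_map (adjoint_tmulRight_comp x x') (adjoint_tmulRight_comp y y') v w

theorem LinearIsometry.adjoint_comp_self_eq {H' : Type} [NormedAddCommGroup H']
    [InnerProductSpace ℂ H'] [CompleteSpace H'] (Φ : H →ₗᵢ[ℂ] H') :
    Φ.toContinuousLinearMap.adjoint ∘L Φ.toContinuousLinearMap = (1 : ℂ) • 1 := by
  rw [one_smul]
  exact (ContinuousLinearMap.norm_map_iff_adjoint_comp_self _).mp Φ.norm_map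

/-- Local isometries preserve inner products, so local reduction determines the correlation. -/
theorem LocallyReducesTo.realizes {KA KB : Type}
    [NormedAddCommGroup KA] [InnerProductSpace ℂ KA] [FiniteDimensional ℂ KA]
    [NormedAddCommGroup KB] [InnerProductSpace ℂ KB] [FiniteDimensional ℂ KB]
    {ψ' : KA ⊗[ℂ] KB} {M' : Fin 2 → Povm KA} {N' : Fin 2 → Povm KB} {P' : Correlation}
    (hred : LocallyReducesTo ψ M N ψ' M' N') (h : Realizes P ψ M N)
    (h' : Realizes P' (HTensor.of ψ') M' N') : P = P' := by
  obtain ⟨HA', HB', _, _, _, _, _, _, ΦA, ΦB, ς, hς, hΦ⟩ := hred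
  have hψ : HTensor.map ΦA.toContinuousLinearMap ΦB.toContinuousLinearMap ψ
      = HTensor.attach ψ' ς := by
    have e1 : ψ = ∑ a, ∑ b, HTensor.map ((M 0).effect a) ((N 0).effect b) ψ := by
      simp only [Fin.sum_univ_two, ← add_apply, ← HTensor.map_add_right, ← HTensor.map_add_left,
        (M 0).sum_eq_one, (N 0).sum_eq_one, HTensor.map_one, one_apply_eq_self]
    have e2 : ψ' = ∑ a, ∑ b, TensorProduct.mapL ((M' 0).effect a) ((N' 0).effect b) ψ' := by
      apply (HTensor.of (H := KA) (K := KB)).injective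
      simp only [map_sum, ← HTensor.map_of]
      simp only [Fin.sum_univ_two, ← add_apply, ← HTensor.map_add_right, ← HTensor.map_add_left,
        (M' 0).sum_eq_one, (N' 0).sum_eq_one, HTensor.map_one, one_apply_eq_self]
    nth_rewrite 1 [e1]
    nth_rewrite 1 [e2]
    simp only [map_sum, hΦ, sum_apply]
  ext a b x y
  apply Complex.ofReal_injective
  have e3 := HTensor.inner_map_map ΦA.adjoint_comp_self_eq ΦB.adjoint_comp_self_eq ψ
    (HTensor.map ((M x).effect a) ((N y).effect b) ψ)
  rw [hΦ, hψ, inner_attach, h.2, ← LinearIsometry.inner_map_map HTensor.of, ← HTensor.map_of, h'.2,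
    inner_self_eq_norm_sq_to_K, hς] at e3
  simpa using e3.symm

omit [CompleteSpace HA] [CompleteSpace HB] in
/-- Local reduction passes from an isometric image of a strategy to the strategy itself if the
isometries intertwine the measurements on the state. -/
theorem LocallyReducesTo.of_isometry {KA KB : Type}
    [NormedAddCommGroup KA] [InnerProductSpace ℂ KA] [FiniteDimensional ℂ KA]
    [NormedAddCommGroup KB] [InnerProductSpace ℂ KB] [FiniteDimensional ℂ KB]
    {ψ' : KA ⊗[ℂ] KB} {M' : Fin 2 → Povm KA} {N' : Fin 2 → Povm KB}
    {LA LB : Type} [NormedAddCommGroup LA] [InnerProductSpace ℂ LA]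
    [NormedAddCommGroup LB] [InnerProductSpace ℂ LB]
    {Q : Fin 2 → Povm LA} {R : Fin 2 → Povm LB} (VA : HA →ₗᵢ[ℂ] LA) (VB : HB →ₗᵢ[ℂ] LB)
    (hV : ∀ a b x y, HTensor.map VA.toContinuousLinearMap VB.toContinuousLinearMap
        (HTensor.map ((M x).effect a) ((N y).effect b) ψ)
      = HTensor.map ((Q x).effect a) ((R y).effect b)
        (HTensor.map VA.toContinuousLinearMap VB.toContinuousLinearMap ψ))
    (hred : LocallyReducesTo
      (HTensor.map VA.toContinuousLinearMap VB.toContinuousLinearMap ψ) Q R ψ' M' N') :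
    LocallyReducesTo ψ M N ψ' M' N' := by
  obtain ⟨HA', HB', _, _, _, _, _, _, ΦA, ΦB, ς, hς, hΦ⟩ := hred
  refine ⟨HA', HB', _, _, inferInstance, _, _, inferInstance, ΦA.comp VA, ΦB.comp VB, ς, hς,
    fun a b x y => ?_⟩
  rw [← hΦ, ← hV]
  exact (HTensor.map_map ΦA.toContinuousLinearMap VA.toContinuousLinearMap
    ΦB.toContinuousLinearMap VB.toContinuousLinearMap _).symm

end Dilation

/-! ### Pure-state strategies with arbitrary measurements -/

section PureStrategies

variable {HA HB : Type} [NormedAddCommGroup HA] [InnerProductSpace ℂ HA] [CompleteSpace HA]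
  [NormedAddCommGroup HB] [InnerProductSpace ℂ HB] [CompleteSpace HB]
  {P : Correlation} {ψ : HTensor HA HB} {M : Fin 2 → Povm HA} {N : Fin 2 → Povm HB}

theorem chshValue_correlationQ3 : chshValue correlationQ3 = 5 / 2 := by
  rw [chshValue_eq]
  norm_num [correlationQ3]

/-- Uniqueness of the correlation at the maximum, through a projective dilation. -/
theorem Realizes.eq_correlationQ3 (h : Realizes P ψ M N) (h0 : P 0 0 0 0 = 0) (h1 : P 1 1 1 0 = 0)
    (hS : chshValue P = 5 / 2) : P = correlationQ3 := by
  obtain ⟨Q, R, hQ, hR, -, -, h'⟩ := h.exists_dilation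
  exact (h'.locallyReducesTo_of_isProjective hQ hR h0 h1 hS).realizes h' refState_realizes

/-- The correlation of a pure-state strategy. -/
def pureCorrelation (ψ : HTensor HA HB) (M : Fin 2 → Povm HA) (N : Fin 2 → Povm HB) :
    Correlation := fun a b x y =>
  (inner ℂ ψ (HTensor.map ((M x).effect a) ((N y).effect b) ψ)).re

theorem realizes_pureCorrelation (hψ : ‖ψ‖ = 1) (M : Fin 2 → Povm HA) (N : Fin 2 → Povm HB) :
    Realizes (pureCorrelation ψ M N) ψ M N := by
  refine ⟨hψ, fun a b x y => (Complex.ext rfl ?_)⟩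
  have hT := HTensor.isPositive_map ((M x).isPositive a) ((N y).isPositive b)
  have := hT.isSelfAdjoint.isSymmetric
  have h2 : (starRingEnd ℂ) (inner ℂ ψ (HTensor.map ((M x).effect a) ((N y).effect b) ψ))
      = inner ℂ ψ (HTensor.map ((M x).effect a) ((N y).effect b) ψ) := by
    rw [inner_conj_symm]; exact this ψ ψ
  rw [Complex.ofReal_im]
  exact Complex.conj_eq_iff_im.mp h2

/-- If a strategy at the maximum is the average of two strategies with the same state, then both
satisfy the zero constraints and attain the maximum, hence have the same correlation. -/
theorem Realizes.pureCorrelation_eq_of_average (h : Realizes P ψ M N) (h0 : P 0 0 0 0 = 0)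
    (h1 : P 1 1 1 0 = 0) (hS : chshValue P = 5 / 2) {M' M'' : Fin 2 → Povm HA}
    {N' N'' : Fin 2 → Povm HB}
    (hav : ∀ a b x y, (2 : ℂ) • HTensor.map ((M x).effect a) ((N y).effect b)
      = HTensor.map ((M' x).effect a) ((N' y).effect b)
        + HTensor.map ((M'' x).effect a) ((N'' y).effect b)) :
    pureCorrelation ψ M' N' = P := by
  have h' := realizes_pureCorrelation h.1 M' N'
  have h'' := realizes_pureCorrelation h.1 M'' N''
  have hsum : ∀ a b x y, 2 * P a b x y
      = pureCorrelation ψ M' N' a b x y + pureCorrelation ψ M'' N'' a b x y := by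
    intro a b x y
    apply Complex.ofReal_injective
    have := congrArg (fun T : HTensor HA HB →L[ℂ] HTensor HA HB => inner ℂ ψ (T ψ)) (hav a b x y)
    simp only [smul_apply, add_apply, inner_smul_right, inner_add_right, h.2, h'.2, h''.2] at this
    rw [Complex.ofReal_mul, Complex.ofReal_add, ← this]
    norm_num
  have z0' : pureCorrelation ψ M' N' 0 0 0 0 = 0 := by
    linarith [hsum 0 0 0 0, h'.nonneg 0 0 0 0, h''.nonneg 0 0 0 0]
  have z0'' : pureCorrelation ψ M'' N'' 0 0 0 0 = 0 := by
    linarith [hsum 0 0 0 0, h'.nonneg 0 0 0 0, h''.nonneg 0 0 0 0]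
  have z1' : pureCorrelation ψ M' N' 1 1 1 0 = 0 := by
    linarith [hsum 1 1 1 0, h'.nonneg 1 1 1 0, h''.nonneg 1 1 1 0]
  have z1'' : pureCorrelation ψ M'' N'' 1 1 1 0 = 0 := by
    linarith [hsum 1 1 1 0, h'.nonneg 1 1 1 0, h''.nonneg 1 1 1 0]
  have hS2 : 2 * chshValue P
      = chshValue (pureCorrelation ψ M' N') + chshValue (pureCorrelation ψ M'' N'') := by
    simp only [chshValue, Finset.mul_sum, ← Finset.sum_add_distrib]
    refine Finset.sum_congr rfl fun x _ => Finset.sum_congr rfl fun y _ =>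
      Finset.sum_congr rfl fun a _ => Finset.sum_congr rfl fun b _ => ?_
    linear_combination (-1 : ℝ) ^ (x.val * y.val + a.val + b.val + 1) * hsum a b x y
  have hS' : chshValue (pureCorrelation ψ M' N') = 5 / 2 := by
    linarith [h'.chshValue_le z0' z1', h''.chshValue_le z0'' z1'']
  rw [h'.eq_correlationQ3 z0' z1' hS', h.eq_correlationQ3 h0 h1 hS]

/-- Every measurement is the average of two measurements with effects `E ^ 2` and `2 E - E ^ 2`. -/
theorem Povm.exists_average {H : Type} [NormedAddCommGroup H] [InnerProductSpace ℂ H]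
    [CompleteSpace H] (M : Povm H) : ∃ L U : Povm H,
      L.effect 0 = M.effect 0 ∘L M.effect 0 ∧
      ∀ a, (2 : ℂ) • M.effect a = L.effect a + U.effect a := by
  have h0 := M.isPositive 0
  have h1 : (1 - M.effect 0).IsPositive := M.effect_one_eq ▸ M.isPositive 1
  obtain ⟨R, hRa, hRR, -⟩ := exists_sqrt_mul_one_sub h0 h1
  set E := M.effect 0 with hE
  have hEE : (E ∘L E).IsPositive := by
    have := ContinuousLinearMap.isPositive_adjoint_comp_self E
    rwa [h0.isSelfAdjoint.adjoint_eq] at this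
  have hFF : ((1 - E) ∘L (1 - E)).IsPositive := by
    have := ContinuousLinearMap.isPositive_adjoint_comp_self (1 - E)
    rwa [h1.isSelfAdjoint.adjoint_eq] at this
  have hR : (R ∘L R).IsPositive := by
    have := ContinuousLinearMap.isPositive_adjoint_comp_self R
    rwa [hRa] at this
  have hRR' : R ∘L R = E - E ∘L E := ContinuousLinearMap.ext hRR
  refine ⟨⟨![E ∘L E, 1 - E + R ∘L R], fun a => ?_, ?_⟩,
    ⟨![E + R ∘L R, (1 - E) ∘L (1 - E)], fun a => ?_, ?_⟩, rfl, fun a => ?_⟩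
  · fin_cases a
    exacts [hEE, h1.add hR]
  · simp only [Matrix.cons_val_zero, Matrix.cons_val_one, hRR']
    abel
  · fin_cases a
    exacts [h0.add hR, hFF]
  · simp only [Matrix.cons_val_zero, Matrix.cons_val_one, hRR']
    ext v
    simp
  · fin_cases a
    · ext v
      simp [hRR, ← hE]
      module
    · ext v
      simp [M.effect_one_eq, hRR, ← hE]
      module

theorem Povm.effect_sub_sq {H : Type} [NormedAddCommGroup H] [InnerProductSpace ℂ H]
    (M : Povm H) (a : Fin 2) : M.effect a - M.effect a ∘L M.effect a
      = M.effect 0 - M.effect 0 ∘L M.effect 0 := by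
  fin_cases a
  · rfl
  · ext v
    simp [M.effect_one_eq]

/-- At the maximum `⟨E⟩ = ⟨E²⟩` for each of Alice's effects `E`: replacing `E` by `E²` or by
`2 E - E²` leaves the correlation unchanged. -/
theorem Realizes.inner_effect_sub_sq_left (h : Realizes P ψ M N) (h0 : P 0 0 0 0 = 0)
    (h1 : P 1 1 1 0 = 0) (hS : chshValue P = 5 / 2) (a x : Fin 2) :
    (inner ℂ ψ (HTensor.map ((M x).effect a - (M x).effect a ∘L (M x).effect a)
      (1 : HB →L[ℂ] HB) ψ)).re = 0 := by
  obtain ⟨L, U, hL, hLU⟩ := (M x).exists_average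
  have heq := h.pureCorrelation_eq_of_average h0 h1 hS (M' := Function.update M x L)
    (M'' := Function.update M x U) (N' := N) (N'' := N) fun a b x' y => by
      by_cases hx : x' = x
      · subst hx
        simp only [Function.update_self]
        rw [← HTensor.map_add_left, ← hLU, HTensor.map_smul_left]
      · simp only [Function.update_of_ne hx]
        rw [two_smul]
  have e1 := (realizes_pureCorrelation h.1 (Function.update M x L) N).sum_right 0 x 0
  rw [heq, h.sum_right, Function.update_self, hL] at e1
  rw [(M x).effect_sub_sq, HTensor.map_sub_left, sub_apply, inner_sub_right, Complex.sub_re, e1,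
    sub_self]

theorem Realizes.inner_effect_sub_sq_right (h : Realizes P ψ M N) (h0 : P 0 0 0 0 = 0)
    (h1 : P 1 1 1 0 = 0) (hS : chshValue P = 5 / 2) (b y : Fin 2) :
    (inner ℂ ψ (HTensor.map (1 : HA →L[ℂ] HA)
      ((N y).effect b - (N y).effect b ∘L (N y).effect b) ψ)).re = 0 := by
  obtain ⟨L, U, hL, hLU⟩ := (N y).exists_average
  have heq := h.pureCorrelation_eq_of_average h0 h1 hS (M' := M) (M'' := M)
    (N' := Function.update N y L) (N'' := Function.update N y U) fun a b x y' => by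
      by_cases hy : y' = y
      · subst hy
        simp only [Function.update_self]
        rw [← HTensor.map_add_right, ← hLU, HTensor.map_smul_right]
      · simp only [Function.update_of_ne hy]
        rw [two_smul]
  have e1 := (realizes_pureCorrelation h.1 M (Function.update N y L)).sum_left 0 0 y
  rw [heq, h.sum_left, Function.update_self, hL] at e1
  rw [(N y).effect_sub_sq, HTensor.map_sub_right, sub_apply, inner_sub_right, Complex.sub_re, e1,
    sub_self]

/-- The failure of `slot 0` to intertwine a measurement with its projective dilation is measured by
the failure `E - E²` of the effect to be idempotent. -/
theorem adjoint_comp_dilation_defect {H : Type} [NormedAddCommGroup H] [InnerProductSpace ℂ H]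
    [CompleteSpace H] {M : Povm H} {Q : Povm (HTensor H Qubit)} (hQ : Q.IsProjective)
    (hQM : ∀ a v, (slot 0).adjoint (Q.effect a (slot 0 v)) = M.effect a v) (a : Fin 2) :
    (slot 0 ∘L M.effect a - Q.effect a ∘L slot 0).adjoint ∘L
      (slot 0 ∘L M.effect a - Q.effect a ∘L slot 0)
        = M.effect a - M.effect a ∘L M.effect a := by
  ext v
  have hQ' : Q.effect a (Q.effect a (slot 0 v)) = Q.effect a (slot 0 v) :=
    DFunLike.congr_fun (hQ a) (slot 0 v)
  simp only [map_sub, ContinuousLinearMap.adjoint_comp, M.adjoint_effect, Q.adjoint_effect,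
    ContinuousLinearMap.comp_apply, sub_apply, adjoint_slot_slot, if_true, hQM, hQ']
  abel

/-- The dilated strategy reduces to the reference strategy, and at the maximum the dilation
intertwines the measurements on the state. -/
theorem Realizes.locallyReducesTo (h : Realizes P ψ M N) (h0 : P 0 0 0 0 = 0) (h1 : P 1 1 1 0 = 0)
    (hS : chshValue P = 5 / 2) :
    LocallyReducesTo ψ M N (refState (Real.pi / 6) (Real.pi / 4))
      (refMeasurement (Real.pi / 6)) (refMeasurement (Real.pi / 4)) := by
  obtain ⟨Q, R, hQ, hR, hQM, hRN, h'⟩ := h.exists_dilation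
  have hred := h'.locallyReducesTo_of_isProjective hQ hR h0 h1 hS
  have hzero : ∀ {V : Type} [NormedAddCommGroup V] [InnerProductSpace ℂ V] (v : V),
      (inner ℂ v v).re = 0 → v = 0 := by
    intro V _ _ v hv
    rw [show (inner ℂ v v).re = ‖v‖ ^ 2 from inner_self_eq_norm_sq (𝕜 := ℂ) v] at hv
    simpa using hv
  have hleft : ∀ a x, HTensor.map (slot 0 ∘L (M x).effect a) (1 : HB →L[ℂ] HB) ψ
      = HTensor.map ((Q x).effect a ∘L slot 0) (1 : HB →L[ℂ] HB) ψ := by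
    intro a x
    rw [← sub_eq_zero, ← sub_apply, ← HTensor.map_sub_left]
    apply hzero
    rw [← ContinuousLinearMap.adjoint_inner_right, HTensor.adjoint_map, HTensor.map_map,
      adjoint_comp_dilation_defect (hQ x) (fun a v => hQM a x v), adjoint_one_eq]
    exact h.inner_effect_sub_sq_left h0 h1 hS a x
  have hright : ∀ b y, HTensor.map (1 : HA →L[ℂ] HA) (slot 0 ∘L (N y).effect b) ψ
      = HTensor.map (1 : HA →L[ℂ] HA) ((R y).effect b ∘L slot 0) ψ := by
    intro b y
    rw [← sub_eq_zero, ← sub_apply, ← HTensor.map_sub_right]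
    apply hzero
    rw [← ContinuousLinearMap.adjoint_inner_right, HTensor.adjoint_map, HTensor.map_map,
      adjoint_comp_dilation_defect (hR y) (fun b v => hRN b y v), adjoint_one_eq]
    exact h.inner_effect_sub_sq_right h0 h1 hS b y
  refine LocallyReducesTo.of_isometry (slotIsometry 0) (slotIsometry 0) (fun a b x y => ?_) hred
  change HTensor.map (slot 0) (slot 0) (HTensor.map ((M x).effect a) ((N y).effect b) ψ)
    = HTensor.map ((Q x).effect a) ((R y).effect b) (HTensor.map (slot 0) (slot 0) ψ)
  calc HTensor.map (slot 0) (slot 0) (HTensor.map ((M x).effect a) ((N y).effect b) ψ)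
      = HTensor.map (1 : HTensor HA Qubit →L[ℂ] HTensor HA Qubit) (slot 0 ∘L (N y).effect b)
          (HTensor.map (slot 0 ∘L (M x).effect a) (1 : HB →L[ℂ] HB) ψ) := by
        rw [HTensor.map_map, HTensor.map_map]; rfl
    _ = HTensor.map ((Q x).effect a ∘L slot 0) (1 : HTensor HB Qubit →L[ℂ] HTensor HB Qubit)
          (HTensor.map (1 : HA →L[ℂ] HA) (slot 0 ∘L (N y).effect b) ψ) := by
        rw [hleft, HTensor.map_map, HTensor.map_map]; rfl
    _ = _ := by
        rw [hright, HTensor.map_map, HTensor.map_map]; rfl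

end PureStrategies

/-! ### Mixed states and the set of quantum correlations -/

section MixedStrategies

/-- A quantum correlation is a countable mixture of correlations of pure-state strategies; of these
only positivity, the bound and uniqueness at the maximum are retained. -/
theorem mem_quantumSet_mixture {P : Correlation} (hP : P ∈ quantumSet) :
    ∃ (w : ℕ → ℝ) (p : ℕ → Correlation), (∀ k, 0 ≤ w k) ∧ HasSum w 1 ∧
      (∀ a b x y, HasSum (fun k => w k * p k a b x y) (P a b x y)) ∧
      (∀ k a b x y, 0 ≤ p k a b x y) ∧
      (∀ k, p k 0 0 0 0 = 0 → p k 1 1 1 0 = 0 → chshValue (p k) ≤ 5 / 2) ∧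
      (∀ k, p k 0 0 0 0 = 0 → p k 1 1 1 0 = 0 → chshValue (p k) = 5 / 2 →
        p k = correlationQ3) := by
  obtain ⟨HA, HB, _, _, _, _, _, _, ρ, M, N, h⟩ := hP
  have hr := fun k => realizes_pureCorrelation (ρ.norm_vec k) M N
  refine ⟨ρ.weight, fun k => pureCorrelation (ρ.vec k) M N, ρ.weight_nonneg, ρ.hasSum_weight,
    fun a b x y => ?_, fun k => (hr k).nonneg, fun k => (hr k).chshValue_le,
    fun k => (hr k).eq_correlationQ3⟩
  have := Complex.hasSum_re (h a b x y)
  simpa only [Complex.re_ofReal_mul, Complex.ofReal_re, pureCorrelation] using this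

/-- Every component of positive weight inherits the zero constraints, hence the bound; at the
maximum every such component has the correlation `correlationQ3`. -/
theorem chshValue_le_and_eq_of_mem_quantumSet2b {P : Correlation} (hP : P ∈ quantumSet2b) :
    chshValue P ≤ 5 / 2 ∧ (chshValue P = 5 / 2 → P = correlationQ3) := by
  obtain ⟨hQ, h0, h1⟩ := hP
  obtain ⟨w, p, hw, hw1, hp, hp0, hle, heq⟩ := mem_quantumSet_mixture hQ
  have hz : ∀ a b x y, P a b x y = 0 → ∀ k, w k ≠ 0 → p k a b x y = 0 := by
    intro a b x y hab k hk
    have hs := hp a b x y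
    rw [hab] at hs
    have := (hasSum_zero_iff_of_nonneg (fun k => mul_nonneg (hw k) (hp0 k a b x y))).mp hs
    exact (mul_eq_zero.mp (congrFun this k)).resolve_left hk
  have hS : HasSum (fun k => w k * chshValue (p k)) (chshValue P) := by
    have : (fun k => w k * chshValue (p k)) = fun k => ∑ x : Fin 2, ∑ y : Fin 2, ∑ a : Fin 2,
        ∑ b : Fin 2, (-1 : ℝ) ^ (x.val * y.val + a.val + b.val + 1) * (w k * p k a b x y) := by
      funext k
      simp only [chshValue, Finset.mul_sum]
      refine Finset.sum_congr rfl fun x _ => Finset.sum_congr rfl fun y _ =>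
        Finset.sum_congr rfl fun a _ => Finset.sum_congr rfl fun b _ => ?_
      ring
    rw [this]
    exact hasSum_sum fun x _ => hasSum_sum fun y _ => hasSum_sum fun a _ => hasSum_sum fun b _ =>
      (hp a b x y).mul_left _
  have hd : HasSum (fun k => w k * (5 / 2 - chshValue (p k))) (5 / 2 - chshValue P) := by
    have := (hw1.mul_right (5 / 2)).sub hS
    simpa only [one_mul, ← mul_sub] using this
  have hd0 : ∀ k, 0 ≤ w k * (5 / 2 - chshValue (p k)) := by
    intro k
    by_cases hk : w k = 0
    · simp [hk]
    · exact mul_nonneg (hw k) (sub_nonneg.mpr (hle k (hz _ _ _ _ h0 k hk) (hz _ _ _ _ h1 k hk)))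
  refine ⟨sub_nonneg.mp (hd.nonneg hd0), fun hmax => ?_⟩
  rw [hmax, sub_self] at hd
  have hk0 := (hasSum_zero_iff_of_nonneg hd0).mp hd
  have hpk : ∀ k, w k ≠ 0 → p k = correlationQ3 := by
    intro k hk
    refine heq k (hz _ _ _ _ h0 k hk) (hz _ _ _ _ h1 k hk) ?_
    have := (mul_eq_zero.mp (congrFun hk0 k)).resolve_left hk
    linarith
  ext a b x y
  have hc : (fun k => w k * p k a b x y) = fun k => w k * correlationQ3 a b x y := by
    funext k
    by_cases hk : w k = 0
    · simp [hk]
    · rw [hpk k hk]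
  have := hp a b x y
  rw [hc] at this
  simpa using this.unique (hw1.mul_right (correlationQ3 a b x y))

/-- A pure state as the mixture in which its first component has weight `1`. -/
def MixedState.pure {H : Type} [NormedAddCommGroup H] [InnerProductSpace ℂ H] (ψ : H)
    (hψ : ‖ψ‖ = 1) : MixedState H where
  weight := Pi.single 0 1
  vec _ := ψ
  weight_nonneg k := by
    rcases eq_or_ne k 0 with rfl | hk
    · simp
    · simp [hk]
  hasSum_weight := hasSum_pi_single 0 1
  norm_vec _ := hψ

theorem Realizes.mem_quantumSet {HA HB : Type} [NormedAddCommGroup HA] [InnerProductSpace ℂ HA]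
    [CompleteSpace HA] [NormedAddCommGroup HB] [InnerProductSpace ℂ HB] [CompleteSpace HB]
    {P : Correlation} {ψ : HTensor HA HB} {M : Fin 2 → Povm HA} {N : Fin 2 → Povm HB}
    (h : Realizes P ψ M N) : P ∈ quantumSet := by
  refine ⟨HA, HB, _, _, inferInstance, _, _, inferInstance, MixedState.pure ψ h.1, M, N,
    fun a b x y => ?_⟩
  have : (fun k => ((Pi.single 0 1 : ℕ → ℝ) k : ℂ)
      * inner ℂ ψ (HTensor.map ((M x).effect a) ((N y).effect b) ψ))
      = Pi.single 0 (P a b x y : ℂ) := by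
    funext k
    rw [h.2]
    rcases eq_or_ne k 0 with rfl | hk
    · simp
    · simp [hk]
  change HasSum (fun k => ((Pi.single 0 1 : ℕ → ℝ) k : ℂ)
      * inner ℂ ψ (HTensor.map ((M x).effect a) ((N y).effect b) ψ)) _
  rw [this]
  exact hasSum_pi_single 0 _

theorem quantumSet_nonneg {P : Correlation} (hP : P ∈ quantumSet) (a b x y : Fin 2) :
    0 ≤ P a b x y := by
  obtain ⟨w, p, hw, -, hp, hp0, -, -⟩ := mem_quantumSet_mixture hP
  exact (hp a b x y).nonneg fun k => mul_nonneg (hw k) (hp0 k a b x y)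

theorem correlationQ3_mem_quantumSet2b : correlationQ3 ∈ quantumSet2b :=
  ⟨refState_realizes.mem_quantumSet, by simp [correlationQ3], by simp [correlationQ3]⟩

/-- The components of a convex decomposition inherit the zero constraints and the maximal CHSH
value. -/
theorem correlationQ3_mem_extremePoints : correlationQ3 ∈ Set.extremePoints ℝ quantumSet := by
  refine ⟨correlationQ3_mem_quantumSet2b.1, ?_⟩
  rintro P hP P' hP' ⟨s, t, hs, ht, hst, heq⟩
  have hv : ∀ a b x y, s * P a b x y + t * P' a b x y = correlationQ3 a b x y := fun a b x y => by
    rw [← heq]; rfl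
  have hz : ∀ a b x y, correlationQ3 a b x y = 0 → P a b x y = 0 ∧ P' a b x y = 0 := by
    intro a b x y hab
    have e := hv a b x y
    have h1 := mul_nonneg hs.le (quantumSet_nonneg hP a b x y)
    have h2 := mul_nonneg ht.le (quantumSet_nonneg hP' a b x y)
    have e1 : s * P a b x y = 0 := by linarith
    have e2 : t * P' a b x y = 0 := by linarith
    exact ⟨(mul_eq_zero.mp e1).resolve_left hs.ne', (mul_eq_zero.mp e2).resolve_left ht.ne'⟩
  have z0 := hz 0 0 0 0 correlationQ3_mem_quantumSet2b.2.1
  have z1 := hz 1 1 1 0 correlationQ3_mem_quantumSet2b.2.2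
  obtain ⟨hle, huniq⟩ := chshValue_le_and_eq_of_mem_quantumSet2b ⟨hP, z0.1, z1.1⟩
  obtain ⟨hle', -⟩ := chshValue_le_and_eq_of_mem_quantumSet2b ⟨hP', z0.2, z1.2⟩
  have hS : s * chshValue P + t * chshValue P' = 5 / 2 := by
    rw [← chshValue_correlationQ3]
    simp only [chshValue_eq, ← hv]
    ring
  refine huniq (le_antisymm hle ?_)
  nlinarith

end MixedStrategies

end

theorem mainTheorem3 :
    IsGreatest (chshValue '' quantumSet2b) (5 / 2) ∧
    (∀ P ∈ quantumSet2b, chshValue P = 5 / 2 ↔ P = correlationQ3) ∧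
    correlationQ3 ∈ Set.extremePoints ℝ quantumSet ∧
    SelfTests correlationQ3 (refState (Real.pi / 6) (Real.pi / 4))
      (refMeasurement (Real.pi / 6)) (refMeasurement (Real.pi / 4)) ∧
    (∀ (HA HB : Type) [NormedAddCommGroup HA] [InnerProductSpace ℂ HA] [CompleteSpace HA]
      [NormedAddCommGroup HB] [InnerProductSpace ℂ HB] [CompleteSpace HB]
      (ψ : HTensor HA HB) (M : Fin 2 → Povm HA) (N : Fin 2 → Povm HB) (P : Correlation),
      Realizes P ψ M N → P 0 0 0 0 = 0 → P 1 1 1 0 = 0 → chshValue P = 5 / 2 →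
      LocallyReducesTo ψ M N (refState (Real.pi / 6) (Real.pi / 4))
        (refMeasurement (Real.pi / 6)) (refMeasurement (Real.pi / 4))) := by
  refine ⟨⟨⟨correlationQ3, correlationQ3_mem_quantumSet2b, chshValue_correlationQ3⟩, ?_⟩,
    fun P hP => ⟨(chshValue_le_and_eq_of_mem_quantumSet2b hP).2, ?_⟩,
    correlationQ3_mem_extremePoints, ⟨refState_realizes, ?_⟩, ?_⟩
  · rintro _ ⟨P, hP, rfl⟩
    exact (chshValue_le_and_eq_of_mem_quantumSet2b hP).1
  · rintro rfl
    exact chshValue_correlationQ3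
  · intro HA HB _ _ _ _ _ _ ψ M N h
    exact h.locallyReducesTo correlationQ3_mem_quantumSet2b.2.1 correlationQ3_mem_quantumSet2b.2.2
      chshValue_correlationQ3
  · intro HA HB _ _ _ _ _ _ ψ M N P h h0 h1 hS
    exact h.locallyReducesTo h0 h1 hS
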